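/- For $n\ge 0$ consider functions $f_n:\{0,1\}^n\times\{0,1\}^n\to\{0,1\}$ (Alice holds $x$, Bob holds $y$). All classes below are non-uniform classes of families $(f_n)_{n\ge 0}$ of such functions. Card protocols. The table has $4n+q$ positions: two input positions for each of the $2n$ input bits, and a work space of $q$ positions. At the beginning every input bit is committed on its two input positions by face-down cards, $1$ as $\heartsuit\clubsuit$ and $0$ as $\clubsuit\heartsuit$; the first $s$ positions of the work space hold a deck of $s$ cards from $\{\heartsuit,\clubsuit\}$ prescribed by the protocol, and the other positions are empty. All cards have the same back. The actions are: move a card to an empty position; turn a card over; shuffle, i.e. apply a uniformly random element of a nonempty set $\Gamma$ of permutations of a set $T$ of work space positions to the positions in $T$. The visible state of the table records for each position whether it is empty, shows a back, or shows a face (and which). Depending on the sequence of visible states seen so far, the protocol prescribes the next (executable) action, or ends and names two positions whose cards are the output. The protocol computes $f_n$ if for all inputs and all outcomes of the shuffles the output cards encode $f_n(x,y)$ ($1$ as $\heartsuit\clubsuit$, $0$ as $\clubsuit\heartsuit$). Its length is the maximal number of actions it executes over all inputs and outcomes of shuffles. It is oblivious if what it does next depends only on the current visible state and the number of actions taken so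 far; read-only if every input position, whenever it is occupied, holds a card of its original suit; secure if $f_n(x,y)=f_n(x',y')$ implies that the sequences of visible states on inputs $(x,y)$ and $(x',y')$ have the same distribution. Let $s$-${\sf SP}$ be the class of families computed by secure read-only oblivious protocols, one for each $n$, of length polynomial in $n$, with deck size $s$ and work space size $q=2s$, and let ${\sf SP}=\bigcup_{s\ge1}s$-${\sf SP}$, the union over constants $s$. Let ${\sf SP}'$ be the variant of ${\sf SP}$ in which the output cards are always left face-down and the distribution of the sequence of visible states has to be the same for all input pairs. Circuits and branching programs. ${\sf NC}^1$ is the class of families computed by Boolean circuits of fan-in two, polynomial size and depth $O(\log n)$ (precisely, at most $c(\lfloor\log_2 n\rfloor+1)$ for a constant $c$, with $\log_2 0$ read as $0$). ${\sf PB}$ is the class of families computed by layered branching programs (over the $2n$ input bits) of constant width and polynomial length. ${\sf PBP}_5$ is the class of families computed by polynomial-length branching programs in which every layer has exactly $5$ vertices, the zero-edges between consecutive layers form a perfect matching and so do the one-edges, and the last layer contains one accepting and one rejecting vertex such that every computation ends in one of these two. Theorem. ${\sf SP}={\sf NC}^1$, and likewise ${\sf SP}'={\sf NC}^1$. Moreover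 ${\sf PBP}_5\subseteq{\sf SP}$ and ${\sf SP}\subseteq{\sf PB}$. -/

import Mathlib

/-! ## Two-party functions -/

inductive Player where
  | alice
  | bob
  deriving DecidableEq

/-- The `2n` input bits of a two-party function: the bits of Alice and the bits of Bob. -/
abbrev InputVar (n : ℕ) : Type := Player × Fin n

/-- The joint input `(x, y)` as an assignment of the `2n` input bits. -/
def joint {n : ℕ} (x y : Fin n → Bool) : InputVar n → Bool
  | (.alice, i) => x i
  | (.bob, i) => y i

/-- A family of functions `f_n : {0,1}^n × {0,1}^n → {0,1}`, `n ≥ 0`. -/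
abbrev Family : Type := (n : ℕ) → (Fin n → Bool) → (Fin n → Bool) → Bool

/-! ## The class `NC¹` (non-uniform) -/

/-- A gate of fan-in at most two which may only read gates with index less than `k`. -/
inductive Gate (V : Type) (k : ℕ) where
  | const (b : Bool)
  | var (v : V)
  | not (i : Fin k)
  | and (i j : Fin k)
  | or (i j : Fin k)

/-- A Boolean circuit with input variables in `V`: an acyclic network of gates of fan-in at most
two and unbounded fan-out, listed in a topological order. -/
structure Circuit (V : Type) where
  size : ℕ
  gate : (i : Fin size) → Gate V i
  out : Fin size

namespace Circuit

variable {V : Type}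

/-- The value of a gate. -/
def gateVal (C : Circuit V) (x : V → Bool) (i : ℕ) (hi : i < C.size) : Bool :=
  match C.gate ⟨i, hi⟩ with
  | .const b => b
  | .var v => x v
  | .not a => !(C.gateVal x a.1 (a.2.trans hi))
  | .and a b => C.gateVal x a.1 (a.2.trans hi) && C.gateVal x b.1 (b.2.trans hi)
  | .or a b => C.gateVal x a.1 (a.2.trans hi) || C.gateVal x b.1 (b.2.trans hi)
termination_by i
decreasing_by
  all_goals first | exact a.2 | exact b.2

/-- The depth of a gate: the length of a longest path that leads to it from a leaf. -/
def gateDepth (C : Circuit V) (i : ℕ) (hi : i < C.size) : ℕ :=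
  match C.gate ⟨i, hi⟩ with
  | .const _ => 0
  | .var _ => 0
  | .not a => C.gateDepth a.1 (a.2.trans hi) + 1
  | .and a b => max (C.gateDepth a.1 (a.2.trans hi)) (C.gateDepth b.1 (b.2.trans hi)) + 1
  | .or a b => max (C.gateDepth a.1 (a.2.trans hi)) (C.gateDepth b.1 (b.2.trans hi)) + 1
termination_by i
decreasing_by
  all_goals first | exact a.2 | exact b.2

def eval (C : Circuit V) (x : V → Bool) : Bool := C.gateVal x C.out.1 C.out.2

def depth (C : Circuit V) : ℕ := C.gateDepth C.out.1 C.out.2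

end Circuit

/-- `NC¹`: families computed by circuits of polynomial size and logarithmic depth. -/
def NC1 : Set Family :=
  {f | ∃ (p : Polynomial ℕ) (c : ℕ), ∀ n : ℕ, ∃ C : Circuit (InputVar n),
    C.size ≤ p.eval n ∧ C.depth ≤ c * (Nat.log 2 n + 1) ∧
      ∀ x y : Fin n → Bool, C.eval (joint x y) = f n x y}

/-! ## Layered branching programs -/

/-- A layered branching program over the variables in `V`.  Its layers are numbered
`0, …, last`; the vertices of layer `i` are `Fin (card i)`.  Every vertex outside the last layer
is labelled by a variable and has one outgoing zero-edge and one outgoing one-edge into the next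
layer. -/
structure BranchingProgram (V : Type) where
  last : ℕ
  card : Fin (last + 1) → ℕ
  label : (i : Fin last) → Fin (card i.castSucc) → V
  edge : (i : Fin last) → Bool → Fin (card i.castSucc) → Fin (card i.succ)
  start : Fin (card 0)
  accepting : Set (Fin (card (Fin.last last)))

namespace BranchingProgram

variable {V : Type}

/-- The number of layers. -/
def length (B : BranchingProgram V) : ℕ := B.last + 1

/-- The active vertex of each layer on the input `x`. -/
def active (B : BranchingProgram V) (x : V → Bool) (i : Fin (B.last + 1)) : Fin (B.card i) :=
  Fin.induction (motive := fun i => Fin (B.card i)) B.start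
    (fun i v => B.edge i (x (B.label i v)) v) i

/-- The vertex of the last layer in which the computation on `x` ends. -/
def final (B : BranchingProgram V) (x : V → Bool) : Fin (B.card (Fin.last B.last)) :=
  B.active x (Fin.last B.last)

def Accepts (B : BranchingProgram V) (x : V → Bool) : Prop := B.final x ∈ B.accepting

/-- `B` has width at most `w`. -/
def WidthAtMost (B : BranchingProgram V) (w : ℕ) : Prop := ∀ i, B.card i ≤ w

/-- `B` is a permutation branching program of width `w`: every layer has exactly `w` vertices, and
between consecutive layers the zero-edges form a perfect matching and so do the one-edges. -/
def IsPermutation (B : BranchingProgram V) (w : ℕ) : Prop :=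
  (∀ i, B.card i = w) ∧ ∀ i b, Function.Bijective (B.edge i b)

/-- `B` is restricted: there are one accepting vertex and one rejecting vertex in the last layer,
and every computation ends in one of these two. -/
def IsRestricted (B : BranchingProgram V) : Prop :=
  ∃ acc rej, acc ≠ rej ∧ B.accepting = {acc} ∧ ∀ x, B.final x = acc ∨ B.final x = rej

end BranchingProgram

/-- Families computed by layered branching programs of constant width and polynomial length. -/
def PB : Set Family :=
  {f | ∃ (w : ℕ) (p : Polynomial ℕ), ∀ n : ℕ, ∃ B : BranchingProgram (InputVar n),
    B.WidthAtMost w ∧ B.length ≤ p.eval n ∧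
      ∀ x y : Fin n → Bool, B.Accepts (joint x y) ↔ f n x y = true}

/-- Families computed by restricted permutation branching programs of width `w` and polynomial
length. -/
def PBP (w : ℕ) : Set Family :=
  {f | ∃ p : Polynomial ℕ, ∀ n : ℕ, ∃ B : BranchingProgram (InputVar n),
    B.IsPermutation w ∧ B.IsRestricted ∧ B.length ≤ p.eval n ∧
      ∀ x y : Fin n → Bool, B.Accepts (joint x y) ↔ f n x y = true}

/-! ## Card-based protocols -/

inductive Suit where
  | heart
  | club
  deriving DecidableEq

/-- A card lying on the table. -/
structure Card where
  suit : Suit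
  faceUp : Bool
  deriving DecidableEq

def Card.turn (c : Card) : Card := ⟨c.suit, !c.faceUp⟩

/-- The 2-card encoding: `1` is heart, club and `0` is club, heart. -/
def encode : Bool → Fin 2 → Suit
  | true, 0 => .heart
  | true, 1 => .club
  | false, 0 => .club
  | false, 1 => .heart

/-- The `4n + q` positions on the table: the input positions (two for each input bit) and the `q`
positions of the work space. -/
inductive Pos (n q : ℕ) where
  | input (v : InputVar n) (c : Fin 2)
  | work (k : Fin q)
  deriving DecidableEq

/-- The state of the table: for each position the card on it, or `none` if it is empty. -/
abbrev Table (n q : ℕ) : Type := Pos n q → Option Card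

/-- What can be seen at a position. -/
inductive Sight where
  | empty
  | back
  | face (s : Suit)
  deriving DecidableEq

def sight : Option Card → Sight
  | none => .empty
  | some c => if c.faceUp then .face c.suit else .back

/-- A visible state of the table. -/
abbrev Visible (n q : ℕ) : Type := Pos n q → Sight

def Table.visible {n q : ℕ} (t : Table n q) : Visible n q := fun i => sight (t i)

/-- The basic actions.  `move p i j`: player `p` moves the card on position `i` to position `j`.
`turn p i`: player `p` turns the card on position `i`.  `shuffle p T Γ`: player `p` applies a
uniformly random element of the nonempty set `Γ` of permutations of `T` (given as permutations of
the work space that fix every position outside `T`) to the positions in `T`. -/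
inductive CardAction (n q : ℕ) where
  | move (p : Player) (i j : Pos n q)
  | turn (p : Player) (i : Pos n q)
  | shuffle (p : Player) (T : Finset (Fin q)) (Γ : Finset (Equiv.Perm (Fin q)))
      (nonempty : Γ.Nonempty) (fixes : ∀ π ∈ Γ, ∀ k, k ∉ T → π k = k)

/-- An action can be executed: one moves a card to an empty position, and one turns a card. -/
def CardAction.Legal {n q : ℕ} : CardAction n q → Table n q → Prop
  | .move _ i j, t => t i ≠ none ∧ t j = none
  | .turn _ i, t => t i ≠ none
  | .shuffle _ _ _ _ _, _ => True

/-- The table after whatever lies on work space position `k` has been carried to `π k`, for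
every `k`. -/
def Table.permute {n q : ℕ} (t : Table n q) (π : Equiv.Perm (Fin q)) : Table n q
  | .input v c => t (.input v c)
  | .work k => t (.work (π.symm k))

/-- The distribution of the table after an action. -/
noncomputable def CardAction.outcome {n q : ℕ} : CardAction n q → Table n q → PMF (Table n q)
  | .move _ i j, t => PMF.pure (fun k => if k = j then t i else if k = i then none else t k)
  | .turn _ i, t => PMF.pure (fun k => if k = i then (t i).map Card.turn else t k)
  | .shuffle _ _ Γ h _, t => (PMF.uniformOfFinset Γ h).map t.permute

/-- What a protocol may prescribe: to execute an action, or to end with the cards on positions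
`i` and `j` (in this order) as the output. -/
inductive Instruction (n q : ℕ) where
  | act (a : CardAction n q)
  | finish (i j : Pos n q)

/-- A protocol for `n`-bit inputs with `s` deck cards and work space of size `q`.  It prescribes
the deck, and for each sequence of visible states seen so far (the current one at the head of the
list) what to do next. -/
structure Protocol (n s q : ℕ) where
  deck : Fin s → Card
  next : List (Visible n q) → Instruction n q

/-- A stage of an execution: the current table, and the visible states from the beginning up to the
current one, the current one first. -/
structure Stage (n q : ℕ) where
  table : Table n q
  history : List (Visible n q)

namespace Protocol

variable {n s q : ℕ}

/-- The table at the beginning: the inputs are committed face-down in the 2-card encoding, the deck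
lies on the first `s` positions of the work space, the other positions are empty. -/
def initialTable (P : Protocol n s q) (x y : Fin n → Bool) : Table n q
  | .input v c => some ⟨encode (joint x y v) c, false⟩
  | .work k => if h : k.1 < s then some (P.deck ⟨k.1, h⟩) else none

def initialStage (P : Protocol n s q) (x y : Fin n → Bool) : Stage n q :=
  ⟨P.initialTable x y, [(P.initialTable x y).visible]⟩

/-- One step of an execution; nothing happens any more once the protocol has ended. -/
noncomputable def step (P : Protocol n s q) (σ : Stage n q) : PMF (Stage n q) :=
  match P.next σ.history with
  | .act a => (a.outcome σ.table).map fun t => ⟨t, t.visible :: σ.history⟩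
  | .finish _ _ => PMF.pure σ

/-- The distribution of the stage reached on inputs `x` and `y` after `k` steps. -/
noncomputable def run (P : Protocol n s q) (x y : Fin n → Bool) : ℕ → PMF (Stage n q)
  | 0 => PMF.pure (P.initialStage x y)
  | k + 1 => (P.run x y k).bind P.step

/-- The stage `σ` occurs with positive probability on inputs `x` and `y`. -/
def Reachable (P : Protocol n s q) (x y : Fin n → Bool) (σ : Stage n q) : Prop :=
  ∃ k, σ ∈ (P.run x y k).support

/-- Every action that the protocol ever prescribes can be executed. -/
def IsLegal (P : Protocol n s q) : Prop :=
  ∀ x y σ a, P.Reachable x y σ → P.next σ.history = .act a → a.Legal σ.table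

/-- The length of the protocol is at most `L`: on all inputs and for all outcomes of shuffling it
ends after at most `L` actions. -/
def LengthAtMost (P : Protocol n s q) (L : ℕ) : Prop :=
  ∀ x y, ∀ σ ∈ (P.run x y L).support, ∃ i j, P.next σ.history = .finish i j

/-- Whenever the protocol ends, its output cards represent `f x y` in the 2-card encoding. -/
def Computes (P : Protocol n s q) (f : (Fin n → Bool) → (Fin n → Bool) → Bool) : Prop :=
  ∀ x y σ i j, P.Reachable x y σ → P.next σ.history = .finish i j →
    (σ.table i).map Card.suit = some (encode (f x y) 0) ∧
      (σ.table j).map Card.suit = some (encode (f x y) 1)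

/-- The next action depends only on the number of actions taken so far and on the current visible
state. -/
def IsOblivious (P : Protocol n s q) : Prop :=
  ∃ g : ℕ → Visible n q → Instruction n q, ∀ v h, P.next (v :: h) = g h.length v

/-- On every input position, whenever it is occupied, there is a card of the original value. -/
def IsReadOnly (P : Protocol n s q) : Prop :=
  ∀ x y σ, P.Reachable x y σ → ∀ v c card,
    σ.table (.input v c) = some card → card.suit = encode (joint x y v) c

/-- The distribution of the sequence of visible states during the first `k` steps. -/
noncomputable def visibleLaw (P : Protocol n s q) (x y : Fin n → Bool) (k : ℕ) :
    PMF (List (Visible n q)) :=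
  (P.run x y k).map Stage.history

/-- Security: the distribution of the sequence of visible states depends only on `f x y`. -/
def IsSecure (P : Protocol n s q) (f : (Fin n → Bool) → (Fin n → Bool) → Bool) : Prop :=
  ∀ x y x' y', f x y = f x' y' → ∀ k, P.visibleLaw x y k = P.visibleLaw x' y' k

/-- The output cards are always left face-down. -/
def HasFaceDownOutput (P : Protocol n s q) : Prop :=
  ∀ x y σ i j, P.Reachable x y σ → P.next σ.history = .finish i j →
    (σ.table i).map Card.faceUp = some false ∧ (σ.table j).map Card.faceUp = some false

/-- Security for protocols with face-down output: the distribution of the sequence of visible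
states is the same on all inputs. -/
def IsFullySecure (P : Protocol n s q) : Prop :=
  ∀ x y x' y' k, P.visibleLaw x y k = P.visibleLaw x' y' k

end Protocol

/-- `s`-`SP`: families computed by secure read-only oblivious protocols of polynomial length with
deck size `s` and work space of size `2s`. -/
def SPWith (s : ℕ) : Set Family :=
  {f | ∃ p : Polynomial ℕ, ∀ n : ℕ, ∃ P : Protocol n s (2 * s),
    P.IsLegal ∧ P.LengthAtMost (p.eval n) ∧ P.Computes (f n) ∧
      P.IsOblivious ∧ P.IsReadOnly ∧ P.IsSecure (f n)}

/-- The class `SP`, the union of `s`-`SP` over all constants `s ≥ 1`. -/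
def SP : Set Family := {f | ∃ s : ℕ, 1 ≤ s ∧ f ∈ SPWith s}

/-- The variant of `s`-`SP` in which the output is provided face-down, and in which accordingly
the visible states must not reveal anything, not even the output. -/
def SPFaceDownWith (s : ℕ) : Set Family :=
  {f | ∃ p : Polynomial ℕ, ∀ n : ℕ, ∃ P : Protocol n s (2 * s),
    P.IsLegal ∧ P.LengthAtMost (p.eval n) ∧ P.Computes (f n) ∧
      P.IsOblivious ∧ P.IsReadOnly ∧ P.HasFaceDownOutput ∧ P.IsFullySecure}

/-- The variant of `SP` with face-down output. -/
def SPFaceDown : Set Family := {f | ∃ s : ℕ, 1 ≤ s ∧ f ∈ SPFaceDownWith s}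

/-! The equalities come from the cycle `NC1` ⊆ `SPFaceDown` ⊆ `SP` ⊆ `PB` ⊆ `NC1`, whose second
inclusion is immediate; `PBP 5` enters through `PB`.

`SP` ⊆ `PB` (`Protocol.exists_branchingProgram`): fix one sequence of visible states that ends the
protocol on some accepted input. By security every accepted input produces it with positive
probability, while a rejected input that produces it must leave the opposite output. Along a fixed
sequence the actions are fixed too, each is influenced by at most one input card, and in a read-only
protocol a face-down input card is determined by one input bit. So a branching program reading one
bit per step can track the set of work space contents compatible with the sequence; the number of
such sets depends on the work space size only.

`PB` ⊆ `NC1` (`BranchingProgram.exists_formula`): guess the vertex in the middle of the computation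
and recurse. Each halving of the length costs constant depth.

`NC1` ⊆ `SPFaceDown`: by Ben-Or and Cleve (`Formula.exists_registerProgram`) a formula of depth `d`
becomes at most `6 ^ d` instructions on three bits, each applying an involution `f` of the eight
states, either always or only if some input bit `x v` is `1`. Eight cards hold the state in one-hot
form, so an unconditional instruction is a rearrangement. For a conditional one, the two cards of `x
v` are taken into the work space beside a helping commitment to `0`. A shuffle with a random bit `b`
applies `f` and inverts both commitments if `b = 1`. The commitment to `β = x v ^^ b` is opened, and
`f` is applied again if `β = 1`; as `f` is an involution, the total effect is `f` exactly if `x v =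
1`. The helping commitment, now to `b`, is inverted if `β = 1`, so it encodes `x v` and returns to
the input; the opened one, inverted likewise, is the new helping `0`. The final table carries no
randomness, and all that is seen is `β`, a fair coin for every input. -/

/-! ### Formulas versus circuits of logarithmic depth -/

/-- Boolean formulas of fan-in two over the variables in `V`. -/
inductive Formula (V : Type) where
  | const (b : Bool)
  | var (v : V)
  | not (A : Formula V)
  | and (A B : Formula V)
  | or (A B : Formula V)

namespace Formula

variable {V : Type}

def eval (x : V → Bool) : Formula V → Bool
  | const b => b
  | var v => x v
  | not A => !(A.eval x)
  | and A B => A.eval x && B.eval x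
  | or A B => A.eval x || B.eval x

def depth : Formula V → ℕ
  | const _ => 0
  | var _ => 0
  | not A => A.depth + 1
  | and A B => max A.depth B.depth + 1
  | or A B => max A.depth B.depth + 1

/-- The gate number `i` of the gate sequence `G` is the root of an unfolding into the formula. -/
def RootedAt (G : (i : ℕ) → Gate V i) : ℕ → Formula V → Prop
  | i, const b => G i = .const b
  | i, var v => G i = .var v
  | i, not A => ∃ a, G i = .not a ∧ RootedAt G a A
  | i, and A B => ∃ a b, G i = .and a b ∧ RootedAt G a A ∧ RootedAt G b B
  | i, or A B => ∃ a b, G i = .or a b ∧ RootedAt G a A ∧ RootedAt G b B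

/-- Gates only refer to gates of smaller index, so appending gates from `m` on leaves every
unfolding rooted below `m` intact. -/
theorem RootedAt.congr {G G' : (i : ℕ) → Gate V i} {m : ℕ} (hG : ∀ i < m, G' i = G i)
    (F : Formula V) : ∀ i < m, RootedAt G i F → RootedAt G' i F := by
  induction F with
  | const b => intro i hi h; simpa [RootedAt, hG i hi] using h
  | var v => intro i hi h; simpa [RootedAt, hG i hi] using h
  | not A ihA =>
    rintro i hi ⟨a, ha, hA⟩
    exact ⟨a, (hG i hi).trans ha, ihA a (a.2.trans hi) hA⟩
  | and A B ihA ihB =>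
    rintro i hi ⟨a, b, ha, hA, hB⟩
    exact ⟨a, b, (hG i hi).trans ha, ihA a (a.2.trans hi) hA, ihB b (b.2.trans hi) hB⟩
  | or A B ihA ihB =>
    rintro i hi ⟨a, b, ha, hA, hB⟩
    exact ⟨a, b, (hG i hi).trans ha, ihA a (a.2.trans hi) hA, ihB b (b.2.trans hi) hB⟩

/-- A formula can be appended to a sequence of gates of length `m`. -/
theorem exists_rootedAt (F : Formula V) : ∀ (G : (i : ℕ) → Gate V i) (m : ℕ),
    ∃ (G' : (i : ℕ) → Gate V i) (o : ℕ), m ≤ o ∧ o + 2 ≤ m + 2 ^ (F.depth + 1) ∧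
      (∀ i < m, G' i = G i) ∧ RootedAt G' o F := by
  induction F with
  | const b =>
    intro G m
    exact ⟨Function.update G m (.const b), m, le_rfl, by simp [depth],
      fun i hi => Function.update_of_ne hi.ne _ _, by simp [RootedAt]⟩
  | var v =>
    intro G m
    exact ⟨Function.update G m (.var v), m, le_rfl, by simp [depth],
      fun i hi => Function.update_of_ne hi.ne _ _, by simp [RootedAt]⟩
  | not A ihA =>
    intro G m
    obtain ⟨G₁, o₁, hm₁, ho₁, hG₁, hA⟩ := ihA G m
    refine ⟨Function.update G₁ (o₁ + 1) (.not ⟨o₁, by omega⟩), o₁ + 1, by omega, ?_, ?_, ?_⟩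
    · have : 2 ^ (A.depth + 1) ≥ 1 := Nat.one_le_two_pow
      simp only [depth, pow_succ _ (A.depth + 1)]
      omega
    · intro i hi
      rw [Function.update_of_ne (by omega), hG₁ i hi]
    · exact ⟨⟨o₁, by omega⟩, by simp, RootedAt.congr (m := o₁ + 1)
        (fun i hi => Function.update_of_ne hi.ne _ _) A o₁ (by omega) hA⟩
  | and A B ihA ihB =>
    intro G m
    obtain ⟨G₁, o₁, hm₁, ho₁, hG₁, hA⟩ := ihA G m
    obtain ⟨G₂, o₂, hm₂, ho₂, hG₂, hB⟩ := ihB G₁ (o₁ + 1)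
    refine ⟨Function.update G₂ (o₂ + 1) (.and ⟨o₁, by omega⟩ ⟨o₂, by omega⟩), o₂ + 1, by omega,
      ?_, ?_, ?_⟩
    · have h₁ : 2 ^ (A.depth + 1) ≤ 2 ^ (max A.depth B.depth + 1) :=
        Nat.pow_le_pow_right (by omega) (by omega)
      have h₂ : 2 ^ (B.depth + 1) ≤ 2 ^ (max A.depth B.depth + 1) :=
        Nat.pow_le_pow_right (by omega) (by omega)
      simp only [depth, pow_succ _ (max A.depth B.depth + 1)]
      omega
    · intro i hi
      rw [Function.update_of_ne (by omega), hG₂ i (by omega), hG₁ i hi]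
    · refine ⟨⟨o₁, by omega⟩, ⟨o₂, by omega⟩, by simp, ?_, ?_⟩
      · refine RootedAt.congr (m := o₁ + 1) (fun i hi => ?_) A o₁ (by omega) hA
        rw [Function.update_of_ne (by omega), hG₂ i hi]
      · exact RootedAt.congr (m := o₂ + 1)
          (fun i hi => Function.update_of_ne hi.ne _ _) B o₂ (by omega) hB
  | or A B ihA ihB =>
    intro G m
    obtain ⟨G₁, o₁, hm₁, ho₁, hG₁, hA⟩ := ihA G m
    obtain ⟨G₂, o₂, hm₂, ho₂, hG₂, hB⟩ := ihB G₁ (o₁ + 1)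
    refine ⟨Function.update G₂ (o₂ + 1) (.or ⟨o₁, by omega⟩ ⟨o₂, by omega⟩), o₂ + 1, by omega,
      ?_, ?_, ?_⟩
    · have h₁ : 2 ^ (A.depth + 1) ≤ 2 ^ (max A.depth B.depth + 1) :=
        Nat.pow_le_pow_right (by omega) (by omega)
      have h₂ : 2 ^ (B.depth + 1) ≤ 2 ^ (max A.depth B.depth + 1) :=
        Nat.pow_le_pow_right (by omega) (by omega)
      simp only [depth, pow_succ _ (max A.depth B.depth + 1)]
      omega
    · intro i hi
      rw [Function.update_of_ne (by omega), hG₂ i (by omega), hG₁ i hi]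
    · refine ⟨⟨o₁, by omega⟩, ⟨o₂, by omega⟩, by simp, ?_, ?_⟩
      · refine RootedAt.congr (m := o₁ + 1) (fun i hi => ?_) A o₁ (by omega) hA
        rw [Function.update_of_ne (by omega), hG₂ i hi]
      · exact RootedAt.congr (m := o₂ + 1)
          (fun i hi => Function.update_of_ne hi.ne _ _) B o₂ (by omega) hB

theorem RootedAt.circuit {G : (i : ℕ) → Gate V i} {m : ℕ} (out : Fin m) (F : Formula V) :
    ∀ (i : ℕ) (hi : i < m), RootedAt G i F →
      (Circuit.mk m (fun i => G i) out).gateDepth i hi = F.depth ∧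
        ∀ x, (Circuit.mk m (fun i => G i) out).gateVal x i hi = F.eval x := by
  induction F with
  | const b =>
    intro i hi h
    simp only [RootedAt] at h
    refine ⟨?_, fun x => ?_⟩
    · rw [Circuit.gateDepth]; simp [h, depth]
    · rw [Circuit.gateVal]; simp [h, eval]
  | var v =>
    intro i hi h
    simp only [RootedAt] at h
    refine ⟨?_, fun x => ?_⟩
    · rw [Circuit.gateDepth]; simp [h, depth]
    · rw [Circuit.gateVal]; simp [h, eval]
  | not A ihA =>
    rintro i hi ⟨a, h, hA⟩
    have hA := ihA a (a.2.trans hi) hA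
    refine ⟨?_, fun x => ?_⟩
    · rw [Circuit.gateDepth]; simp [h, depth, hA.1]
    · rw [Circuit.gateVal]; simp [h, eval, hA.2]
  | and A B ihA ihB =>
    rintro i hi ⟨a, b, h, hA, hB⟩
    have hA := ihA a (a.2.trans hi) hA
    have hB := ihB b (b.2.trans hi) hB
    refine ⟨?_, fun x => ?_⟩
    · rw [Circuit.gateDepth]; simp [h, depth, hA.1, hB.1]
    · rw [Circuit.gateVal]; simp [h, eval, hA.2, hB.2]
  | or A B ihA ihB =>
    rintro i hi ⟨a, b, h, hA, hB⟩
    have hA := ihA a (a.2.trans hi) hA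
    have hB := ihB b (b.2.trans hi) hB
    refine ⟨?_, fun x => ?_⟩
    · rw [Circuit.gateDepth]; simp [h, depth, hA.1, hB.1]
    · rw [Circuit.gateVal]; simp [h, eval, hA.2, hB.2]

/-- No gates are shared, so the size is exponential in the depth; at logarithmic depth this is still
polynomial. -/
theorem exists_circuit (F : Formula V) :
    ∃ C : Circuit V, C.size ≤ 2 ^ (F.depth + 1) ∧ C.depth = F.depth ∧
      ∀ x, C.eval x = F.eval x := by
  obtain ⟨G, o, -, ho, -, hF⟩ := F.exists_rootedAt (fun _ => .const false) 0
  have h := RootedAt.circuit (m := o + 1) (Fin.last o) F o (by omega) hF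
  exact ⟨⟨o + 1, fun i => G i, Fin.last o⟩, by simp only; omega, h.1, h.2⟩

end Formula

/-- Unfolding a circuit duplicates shared gates but keeps the depth, and only the depth matters
afterwards. -/
theorem Circuit.exists_formula_gate {V : Type} (C : Circuit V) (i : ℕ) (hi : i < C.size) :
    ∃ F : Formula V, F.depth = C.gateDepth i hi ∧ ∀ x, F.eval x = C.gateVal x i hi := by
  induction i using Nat.strong_induction_on with
  | _ i ih =>
    cases h : C.gate ⟨i, hi⟩ with
    | const b =>
      refine ⟨.const b, ?_, fun x => ?_⟩
      · rw [gateDepth]; simp [h, Formula.depth]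
      · rw [gateVal]; simp [h, Formula.eval]
    | var v =>
      refine ⟨.var v, ?_, fun x => ?_⟩
      · rw [gateDepth]; simp [h, Formula.depth]
      · rw [gateVal]; simp [h, Formula.eval]
    | not a =>
      obtain ⟨A, hA, hA'⟩ := ih a a.2 (a.2.trans hi)
      refine ⟨.not A, ?_, fun x => ?_⟩
      · rw [gateDepth]; simp [h, Formula.depth, hA]
      · rw [gateVal]; simp [h, Formula.eval, hA']
    | and a b =>
      obtain ⟨A, hA, hA'⟩ := ih a a.2 (a.2.trans hi)
      obtain ⟨B, hB, hB'⟩ := ih b b.2 (b.2.trans hi)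
      refine ⟨.and A B, ?_, fun x => ?_⟩
      · rw [gateDepth]; simp [h, Formula.depth, hA, hB]
      · rw [gateVal]; simp [h, Formula.eval, hA', hB']
    | or a b =>
      obtain ⟨A, hA, hA'⟩ := ih a a.2 (a.2.trans hi)
      obtain ⟨B, hB, hB'⟩ := ih b b.2 (b.2.trans hi)
      refine ⟨.or A B, ?_, fun x => ?_⟩
      · rw [gateDepth]; simp [h, Formula.depth, hA, hB]
      · rw [gateVal]; simp [h, Formula.eval, hA', hB']

/-- Since `n < 2 ^ (log n + 1)`, also for `n = 0`, a monomial of coefficient `a` and degree `k` is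
covered by the exponent factor `a + k`; a sum costs one more factor of two. -/
theorem Polynomial.exists_eval_le_two_pow (p : Polynomial ℕ) :
    ∃ c, ∀ n : ℕ, p.eval n ≤ 2 ^ (c * (Nat.log 2 n + 1)) := by
  induction p using Polynomial.induction_on' with
  | add p q hp hq =>
    obtain ⟨a, ha⟩ := hp
    obtain ⟨b, hb⟩ := hq
    refine ⟨a + b + 1, fun n => ?_⟩
    have h₁ : 2 ^ (a * (Nat.log 2 n + 1)) ≤ 2 ^ ((a + b) * (Nat.log 2 n + 1)) :=
      Nat.pow_le_pow_right (by omega) (Nat.mul_le_mul_right _ (by omega))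
    have h₂ : 2 ^ (b * (Nat.log 2 n + 1)) ≤ 2 ^ ((a + b) * (Nat.log 2 n + 1)) :=
      Nat.pow_le_pow_right (by omega) (Nat.mul_le_mul_right _ (by omega))
    have h₃ : 2 ^ ((a + b) * (Nat.log 2 n + 1) + 1) ≤ 2 ^ ((a + b + 1) * (Nat.log 2 n + 1)) :=
      Nat.pow_le_pow_right (by omega) (by ring_nf; omega)
    rw [Polynomial.eval_add]
    rw [pow_succ] at h₃
    linarith [ha n, hb n]
  | monomial k a =>
    refine ⟨a + k, fun n => ?_⟩
    rw [Polynomial.eval_monomial, add_mul, pow_add]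
    refine Nat.mul_le_mul ?_ ?_
    · exact Nat.lt_two_pow_self.le.trans
        (Nat.pow_le_pow_right (by omega) (Nat.le_mul_of_pos_right _ (by omega)))
    · rw [mul_comm, pow_mul]
      exact Nat.pow_le_pow_left (Nat.lt_pow_succ_log_self (by omega) n).le k

theorem two_pow_log_le (c n : ℕ) :
    2 ^ (c * (Nat.log 2 n + 1)) ≤ ((2 * (Polynomial.X + 1)) ^ c : Polynomial ℕ).eval n := by
  have h : 2 ^ Nat.log 2 n ≤ n + 1 := by
    rcases Nat.eq_zero_or_pos n with rfl | hn
    · simp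
    · exact (Nat.pow_log_le_self 2 hn.ne').trans (by omega)
  rw [Polynomial.eval_pow, mul_comm, pow_mul, pow_succ]
  refine Nat.pow_le_pow_left ?_ c
  simp only [Polynomial.eval_mul, Polynomial.eval_ofNat, Polynomial.eval_add, Polynomial.eval_X,
    Polynomial.eval_one]
  omega

/-- `NC¹` is the class of families computed by formulas of logarithmic depth. -/
theorem mem_NC1_iff (f : Family) :
    f ∈ NC1 ↔ ∃ c : ℕ, ∀ n, ∃ F : Formula (InputVar n), F.depth ≤ c * (Nat.log 2 n + 1) ∧
      ∀ x y, F.eval (joint x y) = f n x y := by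
  constructor
  · rintro ⟨p, c, h⟩
    refine ⟨c, fun n => ?_⟩
    obtain ⟨C, -, hd, hC⟩ := h n
    obtain ⟨F, hF, hF'⟩ := C.exists_formula_gate C.out.1 C.out.2
    exact ⟨F, hF.le.trans hd, fun x y => (hF' _).trans (hC x y)⟩
  · rintro ⟨c, h⟩
    refine ⟨(2 * (Polynomial.X + 1)) ^ (c + 1), c, fun n => ?_⟩
    obtain ⟨F, hd, hF⟩ := h n
    obtain ⟨C, hs, hC, hC'⟩ := F.exists_circuit
    refine ⟨C, hs.trans (le_trans ?_ (two_pow_log_le (c + 1) n)), hC.le.trans hd,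
      fun x y => (hC' _).trans (hF x y)⟩
    refine Nat.pow_le_pow_right (by omega) ?_
    rw [add_mul]
    omega

/-! ### From branching programs of constant width to formulas -/

namespace Formula

variable {V : Type}

/-- The disjunction of the formulas `F 0, …, F (w - 1)`. -/
def disj (F : ℕ → Formula V) : ℕ → Formula V
  | 0 => const false
  | w + 1 => or (disj F w) (F w)

theorem eval_disj (F : ℕ → Formula V) (x : V → Bool) (w : ℕ) :
    (disj F w).eval x = true ↔ ∃ m < w, (F m).eval x = true := by
  induction w with
  | zero => simp [disj, eval]
  | succ w ih =>
    simp only [disj, eval, Bool.or_eq_true, ih, Nat.lt_succ_iff_lt_or_eq]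
    constructor
    · rintro (⟨m, hm, h⟩ | h)
      exacts [⟨m, .inl hm, h⟩, ⟨w, .inr rfl, h⟩]
    · rintro ⟨m, hm | rfl, h⟩
      exacts [.inl ⟨m, hm, h⟩, .inr h]

/-- A linear chain instead of a balanced tree suffices, because it is only used for a constant
number `w` of disjuncts. -/
theorem depth_disj_le {F : ℕ → Formula V} {d : ℕ} (hF : ∀ m, (F m).depth ≤ d) (w : ℕ) :
    (disj F w).depth ≤ d + w := by
  induction w with
  | zero => simp [disj, depth]
  | succ w ih =>
    have := hF w
    simp only [disj, depth]
    omega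

end Formula

namespace BranchingProgram

variable {V : Type} (B : BranchingProgram V)

/-- The vertex that follows the vertex `u` of layer `i`, with vertices as natural numbers. -/
def stepNat (x : V → Bool) (i u : ℕ) : ℕ :=
  if h : ∃ hi : i < B.last, u < B.card (Fin.castSucc ⟨i, hi⟩) then
    (B.edge ⟨i, h.1⟩ (x (B.label ⟨i, h.1⟩ ⟨u, h.2⟩)) ⟨u, h.2⟩).val
  else u

/-- The vertex reached from the vertex `u` of layer `i` after `k` steps. -/
def walk (x : V → Bool) (i : ℕ) : ℕ → ℕ → ℕ
  | 0, u => u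
  | k + 1, u => B.stepNat x (i + k) (walk x i k u)

theorem walk_add (x : V → Bool) (i a b u : ℕ) :
    B.walk x i (a + b) u = B.walk x (i + a) b (B.walk x i a u) := by
  induction b with
  | zero => rfl
  | succ b ih => rw [← add_assoc, walk, walk, ih, add_assoc]

theorem stepNat_of_last_le (x : V → Bool) {i : ℕ} (hi : B.last ≤ i) (u : ℕ) :
    B.stepNat x i u = u :=
  dif_neg fun h => absurd h.1 (by omega)

/-- Walks stand still beyond the last layer, so the length of a program may be rounded up to a power
of two. -/
theorem walk_of_last_le (x : V → Bool) {i : ℕ} (hi : B.last ≤ i) (k u : ℕ) :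
    B.walk x i k u = u := by
  induction k with
  | zero => rfl
  | succ k ih => rw [walk, stepNat_of_last_le _ _ (by omega), ih]

theorem stepNat_lt {w : ℕ} (hw : B.WidthAtMost w) (x : V → Bool) (i : ℕ) {u : ℕ} (hu : u < w) :
    B.stepNat x i u < w := by
  unfold stepNat
  split_ifs with h
  · exact (Fin.is_lt _).trans_le (hw _)
  · exact hu

theorem walk_lt {w : ℕ} (hw : B.WidthAtMost w) (x : V → Bool) (i k : ℕ) {u : ℕ} (hu : u < w) :
    B.walk x i k u < w := by
  induction k with
  | zero => exact hu
  | succ k ih => exact B.stepNat_lt hw x _ ih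

theorem active_eq_walk (x : V → Bool) (i : ℕ) (hi : i < B.last + 1) :
    (B.active x ⟨i, hi⟩).val = B.walk x 0 i B.start := by
  induction i with
  | zero => rfl
  | succ i ih =>
    have hi' : i < B.last := by omega
    have h := ih (by omega)
    have hs : B.active x ⟨i + 1, hi⟩ = B.edge ⟨i, hi'⟩
        (x (B.label ⟨i, hi'⟩ (B.active x ⟨i, by omega⟩))) (B.active x ⟨i, by omega⟩) := by
      exact Fin.induction_succ (motive := fun i => Fin (B.card i)) B.start
        (fun i v => B.edge i (x (B.label i v)) v) ⟨i, hi'⟩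
    rw [hs, walk, zero_add, ← h, stepNat, dif_pos ⟨hi', Fin.is_lt _⟩]
    rfl

/-- A multiplexer on the one variable read at `u`, with both successors hard-wired as constants; its
depth is that of or, and, not. -/
theorem exists_formula_stepNat (i u v : ℕ) :
    ∃ F : Formula V, F.depth ≤ 3 ∧ ∀ x, F.eval x = true ↔ B.stepNat x i u = v := by
  by_cases h : ∃ hi : i < B.last, u < B.card (Fin.castSucc ⟨i, hi⟩)
  · let l := B.label ⟨i, h.1⟩ ⟨u, h.2⟩
    let e := fun b => decide ((B.edge ⟨i, h.1⟩ b ⟨u, h.2⟩).val = v)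
    refine ⟨.or (.and (.var l) (.const (e true))) (.and (.not (.var l)) (.const (e false))),
      by simp [Formula.depth], fun x => ?_⟩
    rw [stepNat, dif_pos h]
    change _ ↔ (B.edge ⟨i, h.1⟩ (x l) ⟨u, h.2⟩).val = v
    cases hx : x l <;> simp [Formula.eval, hx, e]
  · refine ⟨.const (decide (u = v)), by simp [Formula.depth], fun x => ?_⟩
    rw [stepNat, dif_neg h]
    simp [Formula.eval]

/-- Divide and conquer as in Savitch's theorem: a walk of length `2 ^ (k + 1)` splits at one of at
most `w` middle vertices. Each doubling costs one conjunction and a chain of `w` disjunctions, hence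
the summand `w + 1`. -/
theorem exists_formula_walk {w : ℕ} (hw : B.WidthAtMost w) (k : ℕ) :
    ∀ i u v, u < w → ∃ F : Formula V, F.depth ≤ 3 + k * (w + 1) ∧
      ∀ x, F.eval x = true ↔ B.walk x i (2 ^ k) u = v := by
  induction k with
  | zero =>
    intro i u v _
    obtain ⟨F, hd, hF⟩ := B.exists_formula_stepNat i u v
    exact ⟨F, by omega, fun x => by simpa [walk] using hF x⟩
  | succ k ih =>
    intro i u v hu
    have h : ∀ m, ∃ F : Formula V, F.depth ≤ 3 + k * (w + 1) + 1 ∧ (m < w → ∀ x,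
        F.eval x = true ↔ B.walk x i (2 ^ k) u = m ∧ B.walk x (i + 2 ^ k) (2 ^ k) m = v) := by
      intro m
      by_cases hm : m < w
      · obtain ⟨F, hd, hF⟩ := ih i u m hu
        obtain ⟨G, hd', hG⟩ := ih (i + 2 ^ k) m v hm
        refine ⟨.and F G, ?_, fun _ x => by simp [Formula.eval, hF, hG]⟩
        simp only [Formula.depth]
        omega
      · exact ⟨.const false, by simp [Formula.depth], fun h => absurd h hm⟩
    choose F hd hF using h
    refine ⟨Formula.disj F w, (Formula.depth_disj_le hd w).trans (by ring_nf; omega),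
      fun x => ?_⟩
    rw [Formula.eval_disj, pow_succ, mul_two, walk_add]
    constructor
    · rintro ⟨m, hm, h⟩
      obtain ⟨rfl, h⟩ := (hF m hm x).1 h
      exact h
    · intro h
      have hm := B.walk_lt hw x i (2 ^ k) hu
      exact ⟨_, hm, (hF _ hm x).2 ⟨rfl, h⟩⟩

/-- A branching program of width `w` and length at most `2 ^ k` has a formula of depth
`O(w * k)`. -/
theorem exists_formula {w k : ℕ} (hw : B.WidthAtMost w) (hk : B.last ≤ 2 ^ k) :
    ∃ F : Formula V, F.depth ≤ 3 + (k + 1) * (w + 1) ∧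
      ∀ x, F.eval x = true ↔ B.Accepts x := by
  have h : ∀ v, ∃ F : Formula V, F.depth ≤ 3 + k * (w + 1) ∧
      ∀ x, F.eval x = true ↔ v ∈ Fin.val '' B.accepting ∧ B.walk x 0 (2 ^ k) B.start = v := by
    intro v
    by_cases hv : v ∈ Fin.val '' B.accepting
    · obtain ⟨F, hd, hF⟩ := B.exists_formula_walk hw k 0 B.start v (B.start.2.trans_le (hw _))
      exact ⟨F, hd, fun x => by simp only [hF, hv, true_and]⟩
    · exact ⟨.const false, by simp [Formula.depth], fun x => by simp [Formula.eval, hv]⟩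
  choose F hd hF using h
  refine ⟨Formula.disj F w, (Formula.depth_disj_le hd w).trans (by ring_nf; omega),
    fun x => ?_⟩
  have hwalk : B.walk x 0 (2 ^ k) B.start = (B.final x).val := by
    obtain ⟨d, hd⟩ := Nat.exists_eq_add_of_le hk
    rw [hd, walk_add, walk_of_last_le _ _ (by omega)]
    exact (B.active_eq_walk x B.last (by omega)).symm
  rw [Formula.eval_disj]
  constructor
  · rintro ⟨m, -, h⟩
    obtain ⟨⟨u, hu, rfl⟩, h⟩ := (hF m x).1 h
    rw [hwalk] at h
    rwa [Accepts, Fin.ext h]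
  · intro h
    exact ⟨_, (B.final x).2.trans_le (hw _), (hF _ x).2 ⟨⟨_, h, rfl⟩, hwalk⟩⟩

end BranchingProgram

theorem PB_subset_NC1 : PB ⊆ NC1 := by
  rintro f ⟨w, p, h⟩
  rw [mem_NC1_iff]
  obtain ⟨c, hc⟩ := p.exists_eval_le_two_pow
  refine ⟨3 + (c + 1) * (w + 1), fun n => ?_⟩
  obtain ⟨B, hw, hl, hB⟩ := h n
  obtain ⟨F, hd, hF⟩ := B.exists_formula (k := c * (Nat.log 2 n + 1)) hw
    ((Nat.le_succ _).trans (hl.trans (hc n)))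
  refine ⟨F, hd.trans ?_, fun x y => Bool.eq_iff_iff.2 ((hF _).trans (hB x y))⟩
  generalize Nat.log 2 n = l
  nlinarith [Nat.zero_le (l * (w + 1)), Nat.zero_le l]

theorem PBP_subset_PB (w : ℕ) : PBP w ⊆ PB := by
  rintro f ⟨p, h⟩
  refine ⟨w, p, fun n => ?_⟩
  obtain ⟨B, hB, -, hl, hf⟩ := h n
  exact ⟨B, fun i => (hB.1 i).le, hl, hf⟩

/-! ### Simulation of secure protocols by branching programs -/

namespace BranchingProgram

variable {V : Type}

/-- A program with a single layer. -/
def constant (V : Type) (b : Prop) : BranchingProgram V where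
  last := 0
  card := fun _ => 1
  label := fun i => i.elim0
  edge := fun i => i.elim0
  start := 0
  accepting := {_v | b}

/-- The state after `t` steps of an automaton that reads the variable `label t` in step `t`. -/
def trace {Q : Type} (label : ℕ → V) (δ : ℕ → Bool → Q → Q) (q₀ : Q) (x : V → Bool) : ℕ → Q
  | 0 => q₀
  | t + 1 => δ t (x (label t)) (trace label δ q₀ x t)

/-- The states serve as the vertices of every layer, and all vertices of one layer read the same
variable. -/
theorem exists_of_trace {Q : Type} [Finite Q] (L : ℕ) (label : ℕ → V) (δ : ℕ → Bool → Q → Q)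
    (q₀ : Q) (F : Set Q) :
    ∃ B : BranchingProgram V, B.WidthAtMost (Nat.card Q) ∧ B.length = L + 1 ∧
      ∀ x, B.Accepts x ↔ trace label δ q₀ x L ∈ F := by
  let e := Finite.equivFin Q
  let B : BranchingProgram V :=
    { last := L
      card := fun _ => Nat.card Q
      label := fun i _ => label i
      edge := fun i b u => e (δ i b (e.symm u))
      start := e q₀
      accepting := {u | e.symm u ∈ F} }
  refine ⟨B, fun _ => le_rfl, rfl, fun x => ?_⟩
  have h : ∀ t (ht : t < L + 1), B.active x ⟨t, ht⟩ = e (trace label δ q₀ x t) := by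
    intro t
    induction t with
    | zero => intro _; rfl
    | succ t ih =>
      intro ht
      have hs := Fin.induction_succ (motive := fun i => Fin (B.card i)) B.start
        (fun i v => B.edge i (x (B.label i v)) v) ⟨t, Nat.lt_of_succ_lt_succ ht⟩
      refine Eq.trans hs ?_
      have h := ih (Nat.lt_of_succ_lt ht)
      change e (δ t (x (label t)) (e.symm (B.active x ⟨t, Nat.lt_of_succ_lt ht⟩))) = _
      rw [h, e.symm_apply_apply, trace]
  change e.symm (B.active x ⟨L, _⟩) ∈ F ↔ _
  rw [h, e.symm_apply_apply]

end BranchingProgram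

instance : Finite Suit :=
  Finite.of_injective (fun s => decide (s = .heart)) (by
    intro a b; cases a <;> cases b <;> simp)

instance : Finite Card :=
  Finite.of_injective (fun c => (c.suit, c.faceUp)) (by
    rintro ⟨a, b⟩ ⟨c, d⟩; simp)

namespace Table

variable {n q : ℕ}

/-- The contents of the work space. -/
def workspace (t : Table n q) : Fin q → Option Card := fun k => t (.work k)

/-- The table with a given visible state and given contents of the work space, the face-down cards
on input positions being determined by the input `z`. -/
def rebuild (v : Visible n q) (u : Fin q → Option Card) (z : InputVar n → Bool) : Table n q
  | .input a c =>
    match v (.input a c) with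
    | .empty => none
    | .back => some ⟨encode (z a) c, false⟩
    | .face s => some ⟨s, true⟩
  | .work k => u k

/-- The suit of a face-up input card is visible, and that of a face-down one is dictated by the
input if the card has its original value. So apart from the visible state and the input only the
work space needs to be remembered. -/
theorem rebuild_eq (t : Table n q) (z : InputVar n → Bool)
    (h : ∀ a c card, t (.input a c) = some card → card.suit = encode (z a) c) :
    rebuild t.visible t.workspace z = t := by
  funext k
  cases k with
  | work k => rfl
  | input a c =>
    have h := h a c
    simp only [rebuild, visible]
    rcases hk : t (.input a c) with _ | ⟨s, f⟩
    · simp [sight]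
    · have := h _ hk
      simp only at this
      cases f <;> simp [sight, this]

theorem visible_input_rebuild (v : Visible n q) (u : Fin q → Option Card) (z : InputVar n → Bool)
    (a : InputVar n) (c : Fin 2) : (rebuild v u z).visible (.input a c) = v (.input a c) := by
  simp only [visible, rebuild]
  cases v (.input a c) <;> simp [sight]

theorem visible_rebuild_congr (v : Visible n q) (u : Fin q → Option Card)
    (z z' : InputVar n → Bool) : (rebuild v u z).visible = (rebuild v u z').visible := by
  funext k
  cases k with
  | input a c => rw [visible_input_rebuild, visible_input_rebuild]
  | work k => rfl

end Table

/-- The variable committed on a position, if it is an input position. -/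
def Pos.varD {n q : ℕ} (a₀ : InputVar n) : Pos n q → InputVar n
  | .input a _ => a
  | .work _ => a₀

theorem Table.rebuild_apply_congr {n q : ℕ} (v : Visible n q) (u : Fin q → Option Card)
    {z z' : InputVar n → Bool} (a₀ : InputVar n) (i : Pos n q)
    (h : z (i.varD a₀) = z' (i.varD a₀)) : rebuild v u z i = rebuild v u z' i := by
  cases i with
  | input a c =>
    simp only [Pos.varD] at h
    simp [rebuild, h]
  | work k => rfl

namespace CardAction

variable {n q : ℕ}

/-- The input variable on which the effect of an action depends. -/
def varD (a₀ : InputVar n) : CardAction n q → InputVar n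
  | .move _ i _ => i.varD a₀
  | .turn _ i => i.varD a₀
  | .shuffle _ _ _ _ _ => a₀

/-- Only the card being moved or turned matters, and shuffles stay within the work space. Hence an
action depends on a single input bit, which is what one layer of a branching program can read. -/
theorem map_outcome_congr (a : CardAction n q) (a₀ : InputVar n) (v : Visible n q)
    (u : Fin q → Option Card) {z z' : InputVar n → Bool} (h : z (a.varD a₀) = z' (a.varD a₀)) :
    (a.outcome (.rebuild v u z)).map (fun t => (t.visible, t.workspace)) =
      (a.outcome (.rebuild v u z')).map (fun t => (t.visible, t.workspace)) := by
  have hv := Table.visible_rebuild_congr v u z z'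
  cases a with
  | move p i j =>
    have hi := Table.rebuild_apply_congr v u a₀ i h
    simp only [outcome, PMF.pure_map]
    congr 2
    · funext k
      have := congrFun hv k
      simp only [Table.visible] at this ⊢
      rw [hi]
      split_ifs <;> simp [this]
    · funext k
      simp only [Table.workspace, hi]
      rfl
  | turn p i =>
    have hi := Table.rebuild_apply_congr v u a₀ i h
    simp only [outcome, PMF.pure_map]
    congr 2
    · funext k
      have := congrFun hv k
      simp only [Table.visible] at this ⊢
      rw [hi]
      split_ifs <;> simp [this]
    · funext k
      simp only [Table.workspace, hi]
      rfl
  | shuffle p T Γ hΓ hT =>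
    simp only [outcome, PMF.map_comp]
    congr 1
    funext π
    simp only [Function.comp_apply, Prod.mk.injEq]
    refine ⟨?_, rfl⟩
    funext k
    cases k with
    | input a c => exact congrFun hv (.input a c)
    | work k => exact congrFun hv (.work (π.symm k))

end CardAction

namespace Protocol

variable {n s q : ℕ} (P : Protocol n s q)

theorem mem_support_step_of_act {σ σ' : Stage n q} {a : CardAction n q}
    (ha : P.next σ.history = .act a) :
    σ' ∈ (P.step σ).support ↔ ∃ t ∈ (a.outcome σ.table).support,
      σ' = ⟨t, t.visible :: σ.history⟩ := by
  simp only [step, ha, PMF.support_map, Set.mem_image]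
  exact ⟨fun ⟨t, h, e⟩ => ⟨t, h, e.symm⟩, fun ⟨t, h, e⟩ => ⟨t, h, e.symm⟩⟩

theorem mem_support_step_of_finish {σ σ' : Stage n q} {i j : Pos n q}
    (ha : P.next σ.history = .finish i j) : σ' ∈ (P.step σ).support ↔ σ' = σ := by
  simp only [step, ha, PMF.support_pure, Set.mem_singleton_iff]

theorem mem_support_run_succ {x y : Fin n → Bool} {k : ℕ} {σ' : Stage n q} :
    σ' ∈ (P.run x y (k + 1)).support ↔
      ∃ σ ∈ (P.run x y k).support, σ' ∈ (P.step σ).support := by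
  simp only [run, PMF.mem_support_bind_iff]

theorem history_of_mem_support_run {x y : Fin n → Bool} {k : ℕ} {σ : Stage n q}
    (h : σ ∈ (P.run x y k).support) :
    ∃ l, σ.history = σ.table.visible :: l ∧ l.length ≤ k := by
  induction k generalizing σ with
  | zero =>
    simp only [run, PMF.support_pure, Set.mem_singleton_iff] at h
    subst h
    exact ⟨[], rfl, le_rfl⟩
  | succ k ih =>
    obtain ⟨σ', h', hσ⟩ := P.mem_support_run_succ.1 h
    obtain ⟨l, hl, hk⟩ := ih h'
    cases ha : P.next σ'.history with
    | act a =>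
      obtain ⟨t, -, rfl⟩ := (P.mem_support_step_of_act ha).1 hσ
      exact ⟨σ'.history, rfl, by simp [hl, hk]⟩
    | finish i j =>
      obtain rfl := (P.mem_support_step_of_finish ha).1 hσ
      exact ⟨l, hl, by omega⟩

/-- An execution that runs forever. -/
noncomputable def path (x y : Fin n → Bool) : ℕ → Stage n q
  | 0 => P.initialStage x y
  | k + 1 => (P.step (path x y k)).support_nonempty.choose

theorem path_succ_mem (x y : Fin n → Bool) (k : ℕ) :
    P.path x y (k + 1) ∈ (P.step (P.path x y k)).support :=
  (P.step (P.path x y k)).support_nonempty.choose_spec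

theorem path_mem (x y : Fin n → Bool) (k : ℕ) : P.path x y k ∈ (P.run x y k).support := by
  induction k with
  | zero => simp [run, path]
  | succ k ih => exact P.mem_support_run_succ.2 ⟨_, ih, P.path_succ_mem x y k⟩

/-- The contents of the work space that can occur after `k` steps together with the history `h`. -/
def workspaces (h : List (Visible n q)) (x y : Fin n → Bool) (k : ℕ) : Set (Fin q → Option Card) :=
  {u | ∃ t : Table n q, (⟨t, h⟩ : Stage n q) ∈ (P.run x y k).support ∧ t.workspace = u}

theorem mem_workspaces_succ {h : List (Visible n q)} {k : ℕ} (hl : h.length = k + 1)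
    {a : CardAction n q} (ha : P.next h = .act a) (v : Visible n q) (x y : Fin n → Bool)
    (u : Fin q → Option Card) :
    u ∈ P.workspaces (v :: h) x y (k + 1) ↔ ∃ t, (⟨t, h⟩ : Stage n q) ∈ (P.run x y k).support ∧
      ∃ t' ∈ (a.outcome t).support, t'.visible = v ∧ t'.workspace = u := by
  constructor
  · rintro ⟨t', ht', rfl⟩
    obtain ⟨⟨t, h'⟩, ht, hs⟩ := P.mem_support_run_succ.1 ht'
    cases ha' : P.next h' with
    | act a' =>
      obtain ⟨t'', ht'', e⟩ := (P.mem_support_step_of_act ha').1 hs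
      simp only [Stage.mk.injEq, List.cons.injEq] at e
      obtain ⟨rfl, rfl, rfl⟩ := e
      rw [ha, Instruction.act.injEq] at ha'
      subst ha'
      exact ⟨t, ht, t', ht'', rfl, rfl⟩
    | finish i j =>
      -- Had the protocol already ended, the stage after `k` steps would have the history `v :: h`
      -- of length `k + 2`, but `k` steps produce at most `k + 1` visible states.
      have e := (P.mem_support_step_of_finish ha').1 hs
      simp only [Stage.mk.injEq] at e
      obtain ⟨l, hl', hk⟩ := P.history_of_mem_support_run ht
      have := congrArg List.length hl'
      rw [← e.2] at this
      simp only [List.length_cons] at this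
      omega
  · rintro ⟨t, ht, t', ht', rfl, rfl⟩
    exact ⟨t', P.mem_support_run_succ.2 ⟨_, ht, (P.mem_support_step_of_act ha).2 ⟨t', ht', rfl⟩⟩,
      rfl⟩

/-- The contents of the work space to which the action `a` can lead from those in `A`, if the visible
state changes from `v` to `v'` and every face-down input card encodes `b`. -/
def transition (a : CardAction n q) (v v' : Visible n q) (b : Bool)
    (A : Set (Fin q → Option Card)) : Set (Fin q → Option Card) :=
  {u' | ∃ u ∈ A, (v', u') ∈ ((a.outcome (.rebuild v u fun _ => b)).map
    (fun t => (t.visible, t.workspace))).support}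

variable {P} in
theorem rebuild_of_reachable (hR : P.IsReadOnly) {x y : Fin n → Bool} {k : ℕ} {t : Table n q}
    {v : Visible n q} {h : List (Visible n q)}
    (ht : (⟨t, v :: h⟩ : Stage n q) ∈ (P.run x y k).support) :
    .rebuild v t.workspace (joint x y) = t := by
  obtain ⟨l, hl, -⟩ := P.history_of_mem_support_run ht
  rw [(List.cons.inj hl).1]
  exact t.rebuild_eq _ fun a c card hc => hR x y _ ⟨k, ht⟩ a c card hc

-- This is the update rule of the simulating automaton: the next set of possible work spaces is a
-- function of the present one and of one input bit, along a prescribed sequence of visible states.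
-- The length condition expresses that the protocol has not stopped earlier.
variable {P} in
theorem workspaces_succ (hR : P.IsReadOnly) {v : Visible n q} {h : List (Visible n q)} {k : ℕ}
    (hl : h.length = k) {a : CardAction n q} (ha : P.next (v :: h) = .act a) (a₀ : InputVar n)
    (v' : Visible n q) (x y : Fin n → Bool) :
    P.workspaces (v' :: v :: h) x y (k + 1) =
      transition a v v' (joint x y (a.varD a₀)) (P.workspaces (v :: h) x y k) := by
  ext u'
  have key : ∀ u, ((a.outcome (.rebuild v u fun _ => joint x y (a.varD a₀))).map
      (fun t => (t.visible, t.workspace))) = ((a.outcome (.rebuild v u (joint x y))).map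
      (fun t => (t.visible, t.workspace))) := fun u => a.map_outcome_congr a₀ v u rfl
  rw [P.mem_workspaces_succ (by simp [hl]) ha]
  simp only [transition, key, Set.mem_ofPred_eq, PMF.support_map, Set.mem_image, Prod.mk.injEq]
  constructor
  · rintro ⟨t, ht, t', ht', rfl, rfl⟩
    refine ⟨t.workspace, ⟨t, ht, rfl⟩, t', ?_, rfl, rfl⟩
    rwa [rebuild_of_reachable hR ht]
  · rintro ⟨u, ⟨t, ht, rfl⟩, t', ht', rfl, rfl⟩
    rw [rebuild_of_reachable hR ht] at ht'
    exact ⟨t, ht, t', ht', rfl, rfl⟩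

variable {P} in
/-- A secure read-only protocol of length at most `L` can be simulated by a branching program whose
width depends on the size of the work space only. -/
theorem exists_branchingProgram {f : (Fin n → Bool) → (Fin n → Bool) → Bool} {L : ℕ}
    (hL : P.LengthAtMost L) (hC : P.Computes f) (hR : P.IsReadOnly) (hS : P.IsSecure f) :
    ∃ B : BranchingProgram (InputVar n), B.WidthAtMost (Nat.card (Set (Fin q → Option Card))) ∧
      B.length ≤ L + 2 ∧ ∀ x y, B.Accepts (joint x y) ↔ f x y = true := by
  have hcard : 1 ≤ Nat.card (Set (Fin q → Option Card)) := Nat.card_pos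
  -- Constant functions are treated separately: otherwise there is an accepted input to follow, and
  -- also an input variable `a₀` that can label layers in which nothing needs to be read.
  by_cases hconst : ∃ b : Prop, ∀ x y, f x y = true ↔ b
  · obtain ⟨b, hb⟩ := hconst
    exact ⟨.constant _ b, fun _ => hcard, by simp [BranchingProgram.length,
      BranchingProgram.constant], fun x y => (hb x y).symm⟩
  obtain ⟨x₀, y₀, h₀⟩ : ∃ x₀ y₀, f x₀ y₀ = true := by
    by_contra! h
    exact hconst ⟨False, fun x y => by simp [h x y]⟩
  obtain ⟨a₀⟩ : Nonempty (InputVar n) := by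
    by_contra h
    rw [not_nonempty_iff, isEmpty_prod] at h
    obtain h | h := h
    · exact h.elim .alice
    · exact hconst ⟨True, fun x y => by simp [Subsingleton.elim x x₀, Subsingleton.elim y y₀, h₀]⟩
  -- The reference execution on an accepted input. Its visible states up to the first halting time
  -- `K` are hard-wired into the branching program.
  let ρ := P.path x₀ y₀
  have hρ : ∀ k, ρ k ∈ (P.run x₀ y₀ k).support := P.path_mem x₀ y₀
  have hfin : ∃ k, ∃ i j, P.next (ρ k).history = .finish i j := ⟨L, hL _ _ _ (hρ L)⟩
  classical
  let K := Nat.find hfin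
  have hKL : K ≤ L := Nat.find_min' hfin (hL _ _ _ (hρ L))
  obtain ⟨i, j, hij⟩ := Nat.find_spec hfin
  have hact : ∀ k, ∃ a, k < K → P.next (ρ k).history = .act a := by
    intro k
    cases ha : P.next (ρ k).history with
    | act a => exact ⟨a, fun _ => rfl⟩
    | finish i j =>
      -- A dummy action, since the times `k ≥ K` do not matter.
      refine ⟨.turn .alice i, fun hk => absurd ⟨i, j, ha⟩ (Nat.find_min hfin hk)⟩
  choose a ha using hact
  let v : ℕ → Visible n q := fun k => (ρ k).table.visible
  have hhist : ∀ k < K, (ρ (k + 1)).history = v (k + 1) :: (ρ k).history := by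
    intro k hk
    obtain ⟨t, -, e⟩ := (P.mem_support_step_of_act (ha k hk)).1 (P.path_succ_mem x₀ y₀ k)
    simp only [v, ρ, e]
  have hform : ∀ k ≤ K, ∃ l, (ρ k).history = v k :: l ∧ l.length = k := by
    intro k
    induction k with
    | zero => intro _; exact ⟨[], rfl, rfl⟩
    | succ k ih =>
      intro hk
      obtain ⟨l, hl, hl'⟩ := ih (by omega)
      exact ⟨_, hhist k (by omega), by simp [hl, hl']⟩
  let label : ℕ → InputVar n := fun k => if k < K then (a k).varD a₀ else i.varD a₀
  -- The extra step at time `K` keeps the contents for which the first output card is a heart; it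
  -- may have to read a variable because that card may lie on an input position.
  let δ : ℕ → Bool → Set (Fin q → Option Card) → Set (Fin q → Option Card) := fun k b A =>
    if k < K then transition (a k) (v k) (v (k + 1)) b A
    else {u ∈ A | (Table.rebuild (v K) u (fun _ => b) i).map Card.suit = some .heart}
  let A₀ : Set (Fin q → Option Card) := P.workspaces (ρ 0).history x₀ y₀ 0
  obtain ⟨B, hw, hl, hB⟩ := BranchingProgram.exists_of_trace (K + 1) label δ A₀
    {A | A.Nonempty}
  refine ⟨B, hw, by omega, fun x y => ?_⟩
  have hinit : ∀ x y, (P.initialTable x y).visible = (P.initialTable x₀ y₀).visible ∧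
      (P.initialTable x y).workspace = (P.initialTable x₀ y₀).workspace := by
    refine fun x y => ⟨funext fun k => ?_, rfl⟩
    cases k <;> rfl
  have htrace : ∀ k ≤ K, BranchingProgram.trace label δ A₀ (joint x y) k =
      P.workspaces (ρ k).history x y k := by
    intro k
    induction k with
    | zero =>
      intro _
      ext u
      simp only [BranchingProgram.trace, A₀, workspaces, run, PMF.support_pure,
        Set.mem_singleton_iff, Set.mem_ofPred_eq, ρ, path, initialStage, Stage.mk.injEq]
      constructor
      · rintro ⟨t, ⟨rfl, -⟩, rfl⟩
        exact ⟨_, ⟨rfl, by rw [(hinit x y).1]⟩, (hinit x y).2⟩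
      · rintro ⟨t, ⟨rfl, -⟩, rfl⟩
        exact ⟨P.initialTable x₀ y₀, by simp, (hinit x y).2.symm⟩
    | succ k ih =>
      intro hk
      have hk' : k < K := by omega
      obtain ⟨l, hl, hl'⟩ := hform k hk'.le
      have hak := ha k hk'
      rw [BranchingProgram.trace, ih hk'.le, hhist k hk']
      simp only [label, δ, hk', if_true]
      rw [hl] at hak ⊢
      exact (workspaces_succ hR hl' hak a₀ _ x y).symm
  obtain ⟨l, hl, hl'⟩ := hform K le_rfl
  have hfinal : ∀ u ∈ P.workspaces (ρ K).history x y K,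
      (Table.rebuild (v K) u (fun _ => joint x y (i.varD a₀)) i).map Card.suit =
        some (encode (f x y) 0) := by
    rintro u ⟨t, ht, rfl⟩
    rw [Table.rebuild_apply_congr (z := fun _ => joint x y (i.varD a₀)) (z' := joint x y) (v K)
      t.workspace a₀ i rfl]
    have ht' := ht
    rw [hl] at ht'
    rw [rebuild_of_reachable hR ht']
    exact (hC x y _ i j ⟨K, ht⟩ hij).1
  rw [hB, BranchingProgram.trace, htrace K le_rfl]
  simp only [δ, label, lt_irrefl, if_false, Set.mem_ofPred_eq]
  constructor
  · rintro ⟨u, hu, hu'⟩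
    rw [hfinal u hu] at hu'
    cases hf : f x y
    · simp [hf, encode] at hu'
    · rfl
  · intro hf
    -- Security is used here: every accepted input produces the reference sequence with positive
    -- probability, so its final set is nonempty. In the other direction, correctness of the output
    -- alone excludes rejected inputs.
    have hmem : (ρ K).history ∈ (P.visibleLaw x y K).support := by
      rw [hS x y x₀ y₀ (by rw [hf, h₀]) K, visibleLaw, PMF.support_map]
      exact ⟨_, hρ K, rfl⟩
    rw [visibleLaw, PMF.support_map] at hmem
    obtain ⟨⟨t, h'⟩, ht, rfl⟩ := hmem
    refine ⟨t.workspace, ⟨t, ht, rfl⟩, ?_⟩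
    rw [hfinal _ ⟨t, ht, rfl⟩, hf]
    rfl

end Protocol

theorem SP_subset_PB : SP ⊆ PB := by
  rintro f ⟨s, -, p, h⟩
  refine ⟨Nat.card (Set (Fin (2 * s) → Option Card)), p + 2, fun n => ?_⟩
  obtain ⟨P, -, hL, hC, -, hR, hS⟩ := h n
  obtain ⟨B, hw, hl, hB⟩ := Protocol.exists_branchingProgram hL hC hR hS
  exact ⟨B, hw, by simpa using hl, hB⟩

/-! ### Register programs of Ben-Or and Cleve -/

/-- The states of three one-bit registers. -/
abbrev Registers : Type := Fin 3 → Bool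

namespace Registers

/-- If `b` holds, add register `k` to register `j` modulo two. -/
def addIf (b : Bool) (j k : Fin 3) (r : Registers) : Registers :=
  Function.update r j (r j ^^ (b && r k))

theorem addIf_false (j k : Fin 3) (r : Registers) : addIf false j k r = r := by
  simp [addIf]

theorem addIf_addIf {j k : Fin 3} (h : j ≠ k) (a b : Bool) (r : Registers) :
    addIf b j k (addIf a j k r) = addIf (a ^^ b) j k r := by
  funext m
  by_cases hm : m = j
  · subst hm
    cases a <;> cases b <;> simp [addIf, h.symm]
  · simp [addIf, hm]

/-- A commutator of elementary additions: register `l` temporarily receives `b r k` and is then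
restored, while register `j` receives `a (r l + b r k)` and `a r l`, whose sum modulo two is `a b r
k`. -/
theorem addIf_and {j k l : Fin 3} (hjk : j ≠ k) (hlj : l ≠ j) (hlk : l ≠ k) (a b : Bool)
    (r : Registers) :
    addIf a j l (addIf b l k (addIf a j l (addIf b l k r))) = addIf (a && b) j k r := by
  funext m
  by_cases hm : m = j
  · subst hm
    cases a <;> cases b <;> simp [addIf, hjk.symm, hlj, hlj.symm, hlk.symm]
    cases r l <;> cases r k <;> rfl
  · by_cases hm' : m = l
    · subst hm'
      cases a <;> cases b <;> simp [addIf, hjk.symm, hlj, hlj.symm, hlk.symm]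
    · simp [addIf, hm, hm']

end Registers

/-- An instruction: to apply an involution to the state of the registers, either unconditionally
or if a certain variable is `1`. -/
structure RegisterInstr (V : Type) where
  src : Option V
  map : Registers → Registers
  invol : Function.Involutive map

namespace RegisterInstr

variable {V : Type}

def apply (x : V → Bool) (I : RegisterInstr V) (r : Registers) : Registers :=
  if I.src.elim true x then I.map r else r

/-- The instruction that adds register `k` to register `j`. -/
def add (src : Option V) (j k : Fin 3) (h : j ≠ k) : RegisterInstr V :=
  ⟨src, Registers.addIf true j k, fun r => by
    rw [Registers.addIf_addIf h, Bool.xor_self, Registers.addIf_false]⟩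

theorem apply_add (x : V → Bool) (src : Option V) {j k : Fin 3} (h : j ≠ k) (r : Registers) :
    (add src j k h).apply x r = Registers.addIf (src.elim true x) j k r := by
  unfold apply
  split_ifs with hs
  · change src.elim true x = true at hs
    change Registers.addIf true j k r = Registers.addIf (src.elim true x) j k r
    rw [hs]
  · rw [Bool.not_eq_true] at hs
    change src.elim true x = false at hs
    rw [hs, Registers.addIf_false]

/-- The state of the registers after the execution of a program. -/
def run (x : V → Bool) (prog : List (RegisterInstr V)) (r : Registers) : Registers :=
  prog.foldl (fun r I => I.apply x r) r

theorem run_append (x : V → Bool) (p p' : List (RegisterInstr V)) (r : Registers) :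
    run x (p ++ p') r = run x p' (run x p r) := List.foldl_append

end RegisterInstr

open RegisterInstr in
/-- The theorem of Ben-Or and Cleve over the field with two elements. -/
theorem Formula.exists_registerProgram {V : Type} (F : Formula V) :
    ∀ j k : Fin 3, j ≠ k → ∃ prog : List (RegisterInstr V), prog.length ≤ 6 ^ F.depth ∧
      ∀ x r, run x prog r = Registers.addIf (F.eval x) j k r := by
  have third : ∀ j k : Fin 3, ∃ l, l ≠ j ∧ l ≠ k := by decide
  induction F with
  | const b =>
    intro j k h
    cases b
    · exact ⟨[], by simp, fun x r => (Registers.addIf_false j k r).symm⟩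
    · exact ⟨[add none j k h], by simp [depth], fun x r => apply_add x none h r⟩
  | var v =>
    intro j k h
    exact ⟨[add (some v) j k h], by simp [depth], fun x r => apply_add x (some v) h r⟩
  | not A ihA =>
    intro j k h
    obtain ⟨p, hp, hp'⟩ := ihA j k h
    refine ⟨p ++ [add none j k h], ?_, fun x r => ?_⟩
    · have : 1 ≤ 6 ^ A.depth := Nat.one_le_pow _ _ (by omega)
      simp only [List.length_append, List.length_singleton, depth, pow_succ]
      omega
    · rw [run_append, hp']
      refine (apply_add x none h _).trans ?_
      rw [Registers.addIf_addIf h]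
      simp [eval]
  | and A B ihA ihB =>
    intro j k h
    obtain ⟨l, hlj, hlk⟩ := third j k
    obtain ⟨p, hp, hp'⟩ := ihA j l hlj.symm
    obtain ⟨q, hq, hq'⟩ := ihB l k hlk
    refine ⟨q ++ (p ++ (q ++ p)), ?_, fun x r => ?_⟩
    · have h₁ : 6 ^ A.depth ≤ 6 ^ max A.depth B.depth :=
        Nat.pow_le_pow_right (by omega) (le_max_left _ _)
      have h₂ : 6 ^ B.depth ≤ 6 ^ max A.depth B.depth :=
        Nat.pow_le_pow_right (by omega) (le_max_right _ _)
      simp only [List.length_append, depth, pow_succ]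
      omega
    · simp only [run_append, hp', hq']
      exact Registers.addIf_and h hlj hlk _ _ r
  | or A B ihA ihB =>
    intro j k h
    obtain ⟨l, hlj, hlk⟩ := third j k
    obtain ⟨p, hp, hp'⟩ := ihA j l hlj.symm
    obtain ⟨q, hq, hq'⟩ := ihB l k hlk
    obtain ⟨p₁, hp₁, hp₁'⟩ := ihA j k h
    obtain ⟨q₁, hq₁, hq₁'⟩ := ihB j k h
    refine ⟨p₁ ++ (q₁ ++ (q ++ (p ++ (q ++ p)))), ?_, fun x r => ?_⟩
    · have h₁ : 6 ^ A.depth ≤ 6 ^ max A.depth B.depth :=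
        Nat.pow_le_pow_right (by omega) (le_max_left _ _)
      have h₂ : 6 ^ B.depth ≤ 6 ^ max A.depth B.depth :=
        Nat.pow_le_pow_right (by omega) (le_max_right _ _)
      simp only [List.length_append, depth, pow_succ]
      omega
    · simp only [run_append, hp', hq', hp₁', hq₁']
      -- Modulo two, the disjunction is `a + b + a b`. It takes six recursive programs, whence the
      -- base `6` of the length bound.
      rw [Registers.addIf_and h hlj hlk, Registers.addIf_addIf h, Registers.addIf_addIf h, eval]
      congr 1
      cases A.eval x <;> cases B.eval x <;> rfl

/-! ### Straight-line card programs as protocols -/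

theorem PMF.bind_congr_support {α β : Type} (p : PMF α) {f g : α → PMF β}
    (h : ∀ a ∈ p.support, f a = g a) : p.bind f = p.bind g := by
  ext b
  rw [PMF.bind_apply, PMF.bind_apply]
  refine tsum_congr fun a => ?_
  by_cases ha : p a = 0
  · simp [ha]
  · rw [h a ((p.mem_support_iff a).2 ha)]

/-- Straight-line card protocols: in every step the action is chosen according to the current
visible state. -/
abbrev CardProgram (n q : ℕ) : Type := List (Visible n q → CardAction n q)

namespace CardProgram

variable {n s q : ℕ}

/-- One step of an execution. -/
noncomputable def stepWith (m : Visible n q → CardAction n q) (σ : Stage n q) : PMF (Stage n q) :=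
  ((m σ.table.visible).outcome σ.table).map fun t => ⟨t, t.visible :: σ.history⟩

/-- The distribution of the stage after the execution of a program. -/
noncomputable def exec : CardProgram n q → Stage n q → PMF (Stage n q)
  | [], σ => PMF.pure σ
  | m :: ms, σ => (stepWith m σ).bind (exec ms)

theorem exec_append (ms ms' : CardProgram n q) (σ : Stage n q) :
    exec (ms ++ ms') σ = (exec ms σ).bind (exec ms') := by
  induction ms generalizing σ with
  | nil => simp [exec]
  | cons m ms ih =>
    simp only [List.cons_append, exec, PMF.bind_bind]
    congr 1
    funext σ'
    exact ih σ'

theorem mem_support_stepWith {m : Visible n q → CardAction n q} {σ σ' : Stage n q} :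
    σ' ∈ (stepWith m σ).support ↔ ∃ t ∈ ((m σ.table.visible).outcome σ.table).support,
      σ' = ⟨t, t.visible :: σ.history⟩ := by
  simp only [stepWith, PMF.support_map, Set.mem_image]
  exact ⟨fun ⟨t, h, e⟩ => ⟨t, h, e.symm⟩, fun ⟨t, h, e⟩ => ⟨t, h, e.symm⟩⟩

theorem history_of_mem_support_exec {ms : CardProgram n q} {σ σ' : Stage n q}
    {l : List (Visible n q)} (hσ : σ.history = σ.table.visible :: l)
    (h : σ' ∈ (exec ms σ).support) :
    ∃ l', σ'.history = σ'.table.visible :: l' ∧ l'.length = l.length + ms.length := by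
  induction ms generalizing σ l with
  | nil =>
    simp only [exec, PMF.support_pure, Set.mem_singleton_iff] at h
    subst h
    exact ⟨l, hσ, rfl⟩
  | cons m ms ih =>
    obtain ⟨σ₁, h₁, h₂⟩ := (PMF.mem_support_bind_iff _ _ _).1 h
    obtain ⟨t, -, rfl⟩ := mem_support_stepWith.1 h₁
    obtain ⟨l', hl', hlen⟩ := ih (l := σ.history) rfl h₂
    exact ⟨l', hl', by simp [hlen, hσ]; omega⟩

/-- Every action prepends exactly one visible state, so the history at an earlier time can be
recovered from a later one. -/
theorem map_drop_history_exec (ms : CardProgram n q) (σ : Stage n q) :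
    (exec ms σ).map (fun σ' => σ'.history.drop ms.length) = PMF.pure σ.history := by
  induction ms generalizing σ with
  | nil => simp [exec, PMF.pure_map]
  | cons m ms ih =>
    have h : ∀ σ', (exec ms σ').map (fun σ'' => σ''.history.drop (ms.length + 1)) =
        PMF.pure (σ'.history.drop 1) := by
      intro σ'
      have := congrArg (PMF.map (List.drop 1)) (ih σ')
      rw [PMF.map_comp, PMF.pure_map] at this
      rw [← this]
      congr 1
      funext σ''
      simp
    simp only [exec, List.length_cons, PMF.map_bind, stepWith, PMF.bind_map, Function.comp_def, h]
    simp

/-- Starting with the table `t`, the program `ms` executes legal actions only, it respects the input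
`z`, and it ends with a table that satisfies `Q`. -/
def Safe (z : InputVar n → Bool) (Q : Table n q → Prop) : CardProgram n q → Table n q → Prop
  | [], t => (∀ v c card, t (.input v c) = some card → card.suit = encode (z v) c) ∧ Q t
  | m :: ms, t => (∀ v c card, t (.input v c) = some card → card.suit = encode (z v) c) ∧
      (m t.visible).Legal t ∧ ∀ t' ∈ ((m t.visible).outcome t).support, Safe z Q ms t'

theorem Safe.readOnly {z : InputVar n → Bool} {Q : Table n q → Prop} {ms : CardProgram n q}
    {t : Table n q} (h : Safe z Q ms t) :
    ∀ v c card, t (.input v c) = some card → card.suit = encode (z v) c := by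
  cases ms <;> exact h.1

theorem safe_append {z : InputVar n → Bool} {Q : Table n q → Prop} (ms ms' : CardProgram n q)
    (t : Table n q) : Safe z Q (ms ++ ms') t ↔ Safe z (Safe z Q ms') ms t := by
  induction ms generalizing t with
  | nil => exact ⟨fun h => ⟨h.readOnly, h⟩, fun h => h.2⟩
  | cons m ms ih => simp only [List.cons_append, Safe, ih]

theorem Safe.mono {z : InputVar n → Bool} {Q Q' : Table n q → Prop} (hQ : ∀ t, Q t → Q' t)
    {ms : CardProgram n q} {t : Table n q} (h : Safe z Q ms t) : Safe z Q' ms t := by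
  induction ms generalizing t with
  | nil => exact ⟨h.1, hQ _ h.2⟩
  | cons m ms ih => exact ⟨h.1, h.2.1, fun t' ht' => ih (h.2.2 t' ht')⟩

theorem Safe.of_mem_support {z : InputVar n → Bool} {Q : Table n q → Prop} {ms : CardProgram n q}
    {σ σ' : Stage n q} (h : Safe z Q ms σ.table) (hσ : σ' ∈ (exec ms σ).support) :
    Q σ'.table := by
  induction ms generalizing σ with
  | nil =>
    simp only [exec, PMF.support_pure, Set.mem_singleton_iff] at hσ
    subst hσ
    exact h.2
  | cons m ms ih =>
    obtain ⟨σ₁, h₁, h₂⟩ := (PMF.mem_support_bind_iff _ _ _).1 hσ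
    obtain ⟨t, ht, rfl⟩ := mem_support_stepWith.1 h₁
    exact ih (h.2.2 t ht) h₂

/-- The protocol that executes a program and then outputs the cards on positions `i` and `j`. -/
def toProtocol (ms : CardProgram n q) (deck : Fin s → Card) (i j : Pos n q) : Protocol n s q where
  deck := deck
  next
    | [] => .finish i j
    | v :: h =>
      match ms[h.length]? with
      | some m => .act (m v)
      | none => .finish i j

variable (ms : CardProgram n q) (deck : Fin s → Card) (i j : Pos n q)

theorem isOblivious_toProtocol : (ms.toProtocol deck i j).IsOblivious :=
  ⟨fun t v => match ms[t]? with
    | some m => .act (m v)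
    | none => .finish i j, fun _ _ => rfl⟩

/-- The length of the history counts the executed actions and so selects the right instruction; once
the program is exhausted the protocol idles. -/
theorem run_toProtocol (x y : Fin n → Bool) (k : ℕ) :
    (ms.toProtocol deck i j).run x y k =
      exec (ms.take k) ((ms.toProtocol deck i j).initialStage x y) := by
  induction k with
  | zero => rfl
  | succ k ih =>
    rw [Protocol.run, ih]
    rcases lt_or_ge k ms.length with hk | hk
    · rw [List.take_succ_eq_append_getElem hk, exec_append]
      refine PMF.bind_congr_support _ fun σ hσ => ?_
      obtain ⟨l, hl, hlen⟩ := history_of_mem_support_exec rfl hσ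
      have hlk : l.length = k := by simp [hlen, hk.le]
      simp [Protocol.step, toProtocol, hl, hlk, hk, exec, stepWith]
    · rw [List.take_of_length_le hk, List.take_of_length_le (by omega : ms.length ≤ k + 1)]
      refine (PMF.bind_congr_support _ fun σ hσ => ?_).trans (PMF.bind_pure _)
      obtain ⟨l, hl, hlen⟩ := history_of_mem_support_exec rfl hσ
      have hlk : l.length = ms.length := by simp [hlen]
      simp [Protocol.step, toProtocol, hl, hlk]

theorem next_toProtocol {x y : Fin n → Bool} {k : ℕ} {σ : Stage n q}
    (hσ : σ ∈ (exec (ms.take k) ((ms.toProtocol deck i j).initialStage x y)).support) :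
    (ms.toProtocol deck i j).next σ.history =
      match ms[min k ms.length]? with
      | some m => .act (m σ.table.visible)
      | none => .finish i j := by
  obtain ⟨l, hl, hlen⟩ := history_of_mem_support_exec rfl hσ
  have hlk : l.length = min k ms.length := by simp [hlen]
  simp only [toProtocol, hl, hlk]

theorem lengthAtMost_toProtocol {L : ℕ} (hL : ms.length ≤ L) :
    (ms.toProtocol deck i j).LengthAtMost L := by
  intro x y σ hσ
  rw [run_toProtocol] at hσ
  refine ⟨i, j, ?_⟩
  rw [next_toProtocol _ _ _ _ hσ]
  simp [hL]

theorem safe_drop_of_mem_support {x y : Fin n → Bool} {Q : Table n q → Prop}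
    (h : Safe (joint x y) Q ms ((ms.toProtocol deck i j).initialTable x y)) {k : ℕ} {σ : Stage n q}
    (hσ : σ ∈ (exec (ms.take k) ((ms.toProtocol deck i j).initialStage x y)).support) :
    Safe (joint x y) Q (ms.drop k) σ.table := by
  rw [← List.take_append_drop k ms, safe_append, List.take_append_drop] at h
  exact Safe.of_mem_support h hσ

theorem isReadOnly_toProtocol (h : ∀ x y, ∃ Q,
    Safe (joint x y) Q ms ((ms.toProtocol deck i j).initialTable x y)) :
    (ms.toProtocol deck i j).IsReadOnly := by
  rintro x y σ ⟨k, hσ⟩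
  rw [run_toProtocol] at hσ
  obtain ⟨Q, hQ⟩ := h x y
  exact (safe_drop_of_mem_support ms deck i j hQ hσ).readOnly

theorem isLegal_toProtocol (h : ∀ x y, ∃ Q,
    Safe (joint x y) Q ms ((ms.toProtocol deck i j).initialTable x y)) :
    (ms.toProtocol deck i j).IsLegal := by
  rintro x y σ a ⟨k, hσ⟩ ha
  rw [run_toProtocol] at hσ
  obtain ⟨Q, hQ⟩ := h x y
  have hs := safe_drop_of_mem_support ms deck i j hQ hσ
  rw [next_toProtocol _ _ _ _ hσ] at ha
  rcases lt_or_ge k ms.length with hk | hk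
  · rw [min_eq_left hk.le, List.getElem?_eq_getElem hk] at ha
    rw [List.drop_eq_getElem_cons hk] at hs
    simp only [Instruction.act.injEq] at ha
    exact ha ▸ hs.2.1
  · simp [min_eq_right hk] at ha

theorem of_finish_toProtocol {x y : Fin n → Bool} {Q : Table n q → Prop}
    (h : Safe (joint x y) Q ms ((ms.toProtocol deck i j).initialTable x y)) {σ : Stage n q}
    {i' j' : Pos n q} (hσ : (ms.toProtocol deck i j).Reachable x y σ)
    (hf : (ms.toProtocol deck i j).next σ.history = .finish i' j') :
    Q σ.table ∧ i' = i ∧ j' = j := by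
  obtain ⟨k, hσ⟩ := hσ
  rw [run_toProtocol] at hσ
  have hs := safe_drop_of_mem_support ms deck i j h hσ
  rw [next_toProtocol _ _ _ _ hσ] at hf
  rcases lt_or_ge k ms.length with hk | hk
  · simp [min_eq_left hk.le, List.getElem?_eq_getElem hk] at hf
  · rw [List.drop_of_length_le hk] at hs
    simp only [min_eq_right hk, List.getElem?_eq_none le_rfl, Instruction.finish.injEq] at hf
    exact ⟨hs.2, hf.1.symm, hf.2.symm⟩

/-- It suffices to compare complete executions: the law of the visible states after `k` steps is the
image of the final law under dropping the later entries. -/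
theorem isFullySecure_toProtocol (h : ∀ x y x' y',
    (exec ms ((ms.toProtocol deck i j).initialStage x y)).map Stage.history =
      (exec ms ((ms.toProtocol deck i j).initialStage x' y')).map Stage.history) :
    (ms.toProtocol deck i j).IsFullySecure := by
  have key : ∀ x y k, (ms.toProtocol deck i j).visibleLaw x y k =
      ((exec ms ((ms.toProtocol deck i j).initialStage x y)).map Stage.history).map
        (List.drop (ms.drop k).length) := by
    intro x y k
    generalize hσ : (ms.toProtocol deck i j).initialStage x y = σ
    conv_rhs => rw [← List.take_append_drop k ms, exec_append, List.take_append_drop]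
    rw [PMF.map_comp, PMF.map_bind, Protocol.visibleLaw, run_toProtocol, hσ, ← PMF.bind_pure_comp]
    congr 1
    funext σ'
    exact (map_drop_history_exec _ σ').symm
  intro x y x' y' k
  rw [key, key, h x y x' y']

theorem safe_cons_of_pure {z : InputVar n → Bool} {Q : Table n q → Prop}
    {m : Visible n q → CardAction n q} {ms : CardProgram n q} {t t' : Table n q}
    (hr : ∀ v c card, t (.input v c) = some card → card.suit = encode (z v) c)
    (hl : (m t.visible).Legal t) (ho : (m t.visible).outcome t = PMF.pure t')
    (h : Safe z Q ms t') : Safe z Q (m :: ms) t := by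
  refine ⟨hr, hl, fun t'' ht'' => ?_⟩
  rw [ho, PMF.support_pure, Set.mem_singleton_iff] at ht''
  rwa [ht'']

theorem exec_cons_of_pure {m : Visible n q → CardAction n q} {ms : CardProgram n q}
    {t t' : Table n q} (h : List (Visible n q)) (ho : (m t.visible).outcome t = PMF.pure t') :
    exec (m :: ms) ⟨t, h⟩ = exec ms ⟨t', t'.visible :: h⟩ := by
  simp [exec, stepWith, ho, PMF.pure_map]

end CardProgram

/-! ### Fair coins and the layout of the work space -/

theorem PMF.uniformOfFinset_pair {α : Type} [DecidableEq α] {a b : α} (hab : a ≠ b)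
    (h : ({a, b} : Finset α).Nonempty) :
    PMF.uniformOfFinset {a, b} h =
      (PMF.uniformOfFintype Bool).map (fun t => if t then b else a) := by
  ext c
  rw [PMF.map_apply, tsum_bool, PMF.uniformOfFinset_apply, Finset.card_pair hab]
  by_cases ha : c = a
  · subst ha
    simp [hab]
  · by_cases hb : c = b
    · subst hb
      simp [ha]
    · simp [ha, hb]

/-- The one-time pad: this is why opening a masked bit reveals nothing. -/
theorem PMF.map_xor_uniformOfFintype (c : Bool) :
    (PMF.uniformOfFintype Bool).map (fun b => c ^^ b) = PMF.uniformOfFintype Bool := by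
  ext b
  rw [PMF.map_apply, tsum_bool]
  cases b <;> cases c <;> simp

/-- The `20` positions of the work space: one for each state of the registers, two for a helping
commitment, two for a control commitment, and eight unused ones. -/
abbrev Slot : Type := (Registers ⊕ Fin 2) ⊕ (Fin 2 ⊕ Fin 8)

namespace Slot

noncomputable def equiv : Slot ≃ Fin (2 * 10) :=
  ((Equiv.sumCongr
    ((Equiv.sumCongr (Fintype.equivFinOfCardEq (n := 8) (by simp)) (Equiv.refl _)).trans
      finSumFinEquiv) finSumFinEquiv).trans finSumFinEquiv).trans (finCongr (by norm_num))

/-- The eight register cards and the two helping cards occupy exactly the first ten positions, where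
the deck lies at the beginning. -/
theorem equiv_inl_lt (s : Registers ⊕ Fin 2) : (equiv (.inl s)).1 < 10 := by
  simp only [equiv, Equiv.trans_apply, Equiv.sumCongr_apply, Sum.map_inl,
    finSumFinEquiv_apply_left, finCongr_apply, Fin.val_cast, Fin.val_castAdd]
  exact Fin.is_lt _

theorem le_equiv_inr (s : Fin 2 ⊕ Fin 8) : 10 ≤ (equiv (.inr s)).1 := by
  simp only [equiv, Equiv.trans_apply, Equiv.sumCongr_apply, Sum.map_inr,
    finSumFinEquiv_apply_right, finCongr_apply, Fin.val_cast, Fin.val_natAdd]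
  omega

/-- The bisection of the helping and the control commitment, combined with a map of the registers. -/
def bisect (f : Registers → Registers) : Slot → Slot
  | .inl (.inl a) => .inl (.inl (f a))
  | .inl (.inr i) => .inl (.inr i.rev)
  | .inr (.inl i) => .inr (.inl i.rev)
  | .inr (.inr k) => .inr (.inr k)

theorem bisect_involutive {f : Registers → Registers} (hf : Function.Involutive f) :
    Function.Involutive (bisect f) := by
  rintro ((a | i) | (i | k)) <;> simp [bisect, hf _]

/-- The exchange of the helping and the control commitment, where both are inverted if `b` holds. -/
def cross (b : Bool) (f : Registers → Registers) : Slot → Slot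
  | .inl (.inl a) => .inl (.inl (if b then f a else a))
  | .inl (.inr i) => .inr (.inl (if b then i.rev else i))
  | .inr (.inl i) => .inl (.inr (if b then i.rev else i))
  | .inr (.inr k) => .inr (.inr k)

theorem cross_involutive (b : Bool) {f : Registers → Registers} (hf : Function.Involutive f) :
    Function.Involutive (cross b f) := by
  rintro ((a | i) | (i | k)) <;> cases b <;> simp [cross, hf _]

/-- The application of a map to the registers. -/
def onRegisters (f : Registers → Registers) : Slot → Slot
  | .inl (.inl a) => .inl (.inl (f a))
  | s => s

theorem onRegisters_involutive {f : Registers → Registers} (hf : Function.Involutive f) :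
    Function.Involutive (onRegisters f) := by
  rintro ((a | i) | s) <;> simp [onRegisters, hf _]

/-- The permutation of the work space given by an involution of the slots. -/
noncomputable def perm {f : Slot → Slot} (hf : Function.Involutive f) : Equiv.Perm (Fin (2 * 10)) :=
  equiv.permCongr hf.toPerm

theorem perm_symm_equiv {f : Slot → Slot} (hf : Function.Involutive f) (s : Slot) :
    (perm hf).symm (equiv s) = equiv (f s) := by
  rw [Equiv.symm_apply_eq]
  simp [perm, Equiv.permCongr_apply, hf s]

/-- Inverting the helping commitment makes the permutation nontrivial even if `f` is the identity,
so that a uniform choice between it and `1` is a fair coin. -/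
theorem perm_bisect_ne_one {f : Registers → Registers} (hf : Function.Involutive f) :
    perm (bisect_involutive hf) ≠ 1 := by
  intro h
  have := perm_symm_equiv (bisect_involutive hf) (.inl (.inr 0))
  rw [h] at this
  have := equiv.injective this
  simp [bisect] at this

/-- The position of the work space with a given role. -/
noncomputable def pos {n : ℕ} (s : Slot) : Pos n (2 * 10) := .work (equiv s)

/-- The cards in the work space: the state `r` of the registers in the one-hot encoding, and the
helping and control cards. -/
def cards (r : Registers) (δ p : Fin 2 → Option Card) : Slot → Option Card
  | .inl (.inl a) => some ⟨if a = r then .heart else .club, false⟩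
  | .inl (.inr i) => δ i
  | .inr (.inl i) => p i
  | .inr (.inr _) => none

end Slot

/-- A face-down commitment to a bit. -/
def commitment (b : Bool) (i : Fin 2) : Option Card := some ⟨encode b i, false⟩

/-- A commitment to a bit with one of the cards face-up. -/
def shown (b : Bool) (j i : Fin 2) : Option Card := some ⟨encode b i, decide (i = j)⟩

theorem commitment_rev (b : Bool) (i : Fin 2) : commitment b i.rev = commitment (!b) i := by
  cases b <;> fin_cases i <;> rfl

/-- The table with the input cards in the set `S` removed. -/
noncomputable def registerTable {n : ℕ} (x : InputVar n → Bool) (S : InputVar n → Fin 2 → Bool)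
    (r : Registers) (δ p : Fin 2 → Option Card) : Table n (2 * 10)
  | .input a c => if S a c then none else some ⟨encode (x a) c, false⟩
  | .work k => Slot.cards r δ p (Slot.equiv.symm k)

/-- The visible state of `registerTable`. -/
noncomputable def registerVisible {n : ℕ} (S : InputVar n → Fin 2 → Bool) (δ p : Fin 2 → Sight) :
    Visible n (2 * 10)
  | .input a c => if S a c then .empty else .back
  | .work k =>
    match Slot.equiv.symm k with
    | .inl (.inl _) => .back
    | .inl (.inr i) => δ i
    | .inr (.inl i) => p i
    | .inr (.inr _) => .empty

section

variable {n : ℕ} (x : InputVar n → Bool) (S : InputVar n → Fin 2 → Bool) (r : Registers)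
  (δ p : Fin 2 → Option Card)

theorem visible_registerTable : (registerTable x S r δ p).visible =
    registerVisible S (fun i => sight (δ i)) (fun i => sight (p i)) := by
  funext k
  cases k with
  | input a c =>
    simp only [Table.visible, registerTable, registerVisible]
    split_ifs <;> simp [sight]
  | work k =>
    simp only [Table.visible, registerTable, registerVisible]
    rcases Slot.equiv.symm k with (a | i) | (i | k) <;> simp [Slot.cards, sight]

theorem registerTable_pos (s : Slot) :
    registerTable x S r δ p (Slot.pos s) = Slot.cards r δ p s := by
  simp [registerTable, Slot.pos]

theorem registerTable_input (a : InputVar n) (c : Fin 2) :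
    registerTable x S r δ p (.input a c) =
      if S a c then none else some ⟨encode (x a) c, false⟩ := rfl

theorem registerVisible_pos (δ p : Fin 2 → Sight) (i : Fin 2) :
    registerVisible S δ p (Slot.pos (.inl (.inr i))) = δ i ∧
      registerVisible S δ p (Slot.pos (.inr (.inl i))) = p i := by
  simp [registerVisible, Slot.pos]

theorem Table.ext_slots {t t' : Table n (2 * 10)} (h : ∀ a c, t (.input a c) = t' (.input a c))
    (h' : ∀ s, t (Slot.pos s) = t' (Slot.pos s)) : t = t' := by
  funext k
  cases k with
  | input a c => exact h a c
  | work k => simpa [Slot.pos] using h' (Slot.equiv.symm k)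

theorem registerTable_readOnly (a : InputVar n) (c : Fin 2) (card : Card)
    (h : registerTable x S r δ p (.input a c) = some card) : card.suit = encode (x a) c := by
  simp only [registerTable] at h
  split_ifs at h
  rw [← Option.some.inj h]

theorem pos_ne_input (s : Slot) (a : InputVar n) (c : Fin 2) : Slot.pos s ≠ .input a c := by
  simp [Slot.pos]

theorem pos_inj {s s' : Slot} : (Slot.pos s : Pos n (2 * 10)) = Slot.pos s' ↔ s = s' := by
  simp [Slot.pos]

theorem permute_registerTable {f : Slot → Slot} (hf : Function.Involutive f) {r' : Registers}
    {δ' p' : Fin 2 → Option Card}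
    (h : ∀ s, Slot.cards r δ p (f s) = Slot.cards r' δ' p' s) :
    (registerTable x S r δ p).permute (Slot.perm hf) = registerTable x S r' δ' p' := by
  refine Table.ext_slots (fun a c => rfl) fun s => ?_
  rw [registerTable_pos, ← h, ← registerTable_pos x S, Slot.pos, Slot.pos, Table.permute,
    Slot.perm_symm_equiv]

theorem permute_one (t : Table n (2 * 10)) : t.permute 1 = t :=
  Table.ext_slots (fun _ _ => rfl) fun _ => rfl

/-- The card of an input is moved to the control position. -/
theorem outcome_move_to_control {S' : InputVar n → Fin 2 → Bool} {p' : Fin 2 → Option Card}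
    (v : InputVar n) (c : Fin 2) (hS : S v c = false)
    (hS' : ∀ a d, S' a d = (S a d || (decide (a = v) && decide (d = c))))
    (hp' : p' = Function.update p c (commitment (x v) c)) :
    (CardAction.move .alice (.input v c) (Slot.pos (.inr (.inl c)))).outcome
      (registerTable x S r δ p) = PMF.pure (registerTable x S' r δ p') := by
  rw [CardAction.outcome]
  congr 1
  refine Table.ext_slots (fun a d => ?_) fun s => ?_
  · rw [if_neg (pos_ne_input _ _ _).symm]
    by_cases h : a = v ∧ d = c
    · simp [h.1, h.2, registerTable, hS']
    · simp only [Pos.input.injEq, h, if_false, registerTable, hS']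
      have : (decide (a = v) && decide (d = c)) = false := by simpa using h
      rw [this, Bool.or_false]
  · simp only [pos_inj, pos_ne_input, if_false, registerTable_pos]
    rcases s with (a | i) | (i | k)
    · simp [Slot.cards]
    · simp [Slot.cards]
    · by_cases hi : i = c
      · subst hi
        simp [Slot.cards, hp', registerTable, hS, commitment]
      · simp [Slot.cards, hp', hi]
    · simp [Slot.cards]

/-- A control card is moved to an input position. -/
theorem outcome_move_of_control {S' : InputVar n → Fin 2 → Bool} {p' : Fin 2 → Option Card}
    (v : InputVar n) (c : Fin 2) (hp : p c = commitment (x v) c)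
    (hS' : ∀ a d, S' a d = (S a d && !(decide (a = v) && decide (d = c))))
    (hp' : p' = Function.update p c none) :
    (CardAction.move .alice (Slot.pos (.inr (.inl c))) (.input v c)).outcome
      (registerTable x S r δ p) = PMF.pure (registerTable x S' r δ p') := by
  rw [CardAction.outcome]
  congr 1
  refine Table.ext_slots (fun a d => ?_) fun s => ?_
  · by_cases h : a = v ∧ d = c
    · rw [h.1, h.2, if_pos rfl, registerTable_pos]
      simp [Slot.cards, hp, registerTable, hS', commitment]
    · rw [if_neg (pos_ne_input _ _ _).symm]
      simp only [Pos.input.injEq, h, if_false, registerTable, hS']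
      have : (decide (a = v) && decide (d = c)) = false := by simpa using h
      rw [this, Bool.not_false, Bool.and_true]
  · simp only [pos_inj, pos_ne_input, if_false, registerTable_pos]
    rcases s with (a | i) | (i | k)
    · simp [Slot.cards]
    · simp [Slot.cards]
    · by_cases hi : i = c
      · subst hi
        simp [Slot.cards, hp']
      · simp [Slot.cards, hp', hi]
    · simp [Slot.cards]

theorem outcome_turn_control {p' : Fin 2 → Option Card} (c : Fin 2)
    (hp' : p' = Function.update p c ((p c).map Card.turn)) :
    (CardAction.turn .alice (Slot.pos (.inr (.inl c)))).outcome
      (registerTable x S r δ p) = PMF.pure (registerTable x S r δ p') := by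
  rw [CardAction.outcome]
  congr 1
  refine Table.ext_slots (fun a d => ?_) fun s => ?_
  · rw [if_neg (pos_ne_input _ _ _).symm]
    rfl
  · simp only [pos_inj, registerTable_pos]
    rcases s with (a | i) | (i | k)
    · simp [Slot.cards]
    · simp [Slot.cards]
    · by_cases hi : i = c
      · subst hi
        simp [Slot.cards, hp']
      · simp [Slot.cards, hp', hi]
    · simp [Slot.cards]

theorem outcome_turn_helper {δ' : Fin 2 → Option Card} (c : Fin 2)
    (hδ' : δ' = Function.update δ c ((δ c).map Card.turn)) :
    (CardAction.turn .alice (Slot.pos (.inl (.inr c)))).outcome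
      (registerTable x S r δ p) = PMF.pure (registerTable x S r δ' p) := by
  rw [CardAction.outcome]
  congr 1
  refine Table.ext_slots (fun a d => ?_) fun s => ?_
  · rw [if_neg (pos_ne_input _ _ _).symm]
    rfl
  · simp only [pos_inj, registerTable_pos]
    rcases s with (a | i) | (i | k)
    · simp [Slot.cards]
    · by_cases hi : i = c
      · subst hi
        simp [Slot.cards, hδ']
      · simp [Slot.cards, hδ', hi]
    · simp [Slot.cards]
    · simp [Slot.cards]

end

/-- The deterministic rearrangement of the work space by a permutation. -/
def CardAction.rearrange {n q : ℕ} (π : Equiv.Perm (Fin q)) : CardAction n q :=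
  .shuffle .alice Finset.univ {π} (Finset.singleton_nonempty π)
    fun _ _ _ hk => absurd (Finset.mem_univ _) hk

theorem CardAction.outcome_rearrange {n q : ℕ} (π : Equiv.Perm (Fin q)) (t : Table n q) :
    (rearrange π : CardAction n q).outcome t = PMF.pure (t.permute π) := by
  have h : PMF.uniformOfFinset {π} (Finset.singleton_nonempty π) = PMF.pure π := by
    ext π'
    rw [PMF.uniformOfFinset_apply, PMF.pure_apply]
    simp
  rw [rearrange, outcome, h, PMF.pure_map]

/-- The random application of a permutation of the work space with probability one half. -/
def CardAction.bisection {n q : ℕ} (π : Equiv.Perm (Fin q)) : CardAction n q :=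
  .shuffle .alice Finset.univ {1, π} (Finset.insert_nonempty _ _)
    fun _ _ _ hk => absurd (Finset.mem_univ _) hk

theorem CardAction.outcome_bisection {n q : ℕ} {π : Equiv.Perm (Fin q)} (hπ : π ≠ 1)
    (t : Table n q) :
    (bisection π : CardAction n q).outcome t = (PMF.uniformOfFintype Bool).map
      fun b => t.permute (if b then π else 1) := by
  rw [bisection, outcome, PMF.uniformOfFinset_pair hπ.symm, PMF.map_comp]
  rfl

/-- One coin acts on the registers and on both commitments at once; this correlation lets the opened
bit later correct the registers and restore the input. -/
theorem outcome_bisection_registerTable {n : ℕ} (x : InputVar n → Bool)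
    (S : InputVar n → Fin 2 → Bool) (r : Registers) {f : Registers → Registers}
    (hf : Function.Involutive f) (a c : Bool) :
    (CardAction.bisection (Slot.perm (Slot.bisect_involutive hf))).outcome
      (registerTable x S r (commitment a) (commitment c)) =
    (PMF.uniformOfFintype Bool).map fun b =>
      registerTable x S (if b then f r else r) (commitment (a ^^ b)) (commitment (c ^^ b)) := by
  rw [CardAction.outcome_bisection (Slot.perm_bisect_ne_one hf)]
  congr 1
  funext b
  cases b
  · simp [permute_one]
  · simp only [if_true, Bool.xor_true]
    refine permute_registerTable x S r _ _ _ ?_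
    rintro ((a | i) | (i | k))
    · simp only [Slot.bisect, Slot.cards, hf.eq_iff]
    · exact commitment_rev _ _
    · exact commitment_rev _ _
    · rfl

/-- Inverting the opened commitment to `c` exactly if `c` holds turns it into a commitment to `0`;
its face-up card then lies on the second position if `c` holds. -/
theorem outcome_cross_registerTable {n : ℕ} (x : InputVar n → Bool)
    (S : InputVar n → Fin 2 → Bool) (r : Registers) {f : Registers → Registers}
    (hf : Function.Involutive f) (b c : Bool) :
    (CardAction.rearrange (Slot.perm (Slot.cross_involutive c hf))).outcome
      (registerTable x S r (commitment b) (shown c 0)) =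
    PMF.pure (registerTable x S (if c then f r else r) (shown false (if c then 1 else 0))
      (commitment (b ^^ c))) := by
  rw [CardAction.outcome_rearrange]
  congr 1
  refine permute_registerTable x S r _ _ _ ?_
  rintro ((a | i) | (i | k))
  · cases c
    · rfl
    · simp only [Slot.cross, Slot.cards, if_true, hf.eq_iff]
  · cases c <;> fin_cases i <;> rfl
  · cases b <;> cases c <;> fin_cases i <;> rfl
  · rfl

theorem outcome_onRegisters_registerTable {n : ℕ} (x : InputVar n → Bool)
    (S : InputVar n → Fin 2 → Bool) (r : Registers) (δ p : Fin 2 → Option Card)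
    {f : Registers → Registers} (hf : Function.Involutive f) :
    (CardAction.rearrange (Slot.perm (Slot.onRegisters_involutive hf))).outcome
      (registerTable x S r δ p) = PMF.pure (registerTable x S (f r) δ p) := by
  rw [CardAction.outcome_rearrange]
  congr 1
  refine permute_registerTable x S r _ _ _ ?_
  rintro ((a | i) | (i | k))
  · simp only [Slot.onRegisters, Slot.cards, hf.eq_iff]
  · rfl
  · rfl
  · rfl

/-! ### Card programs with a deterministic final table -/

namespace CardProgram

variable {n q : ℕ}

/-- On the table `t` the program `ms` executes legal actions only, respects the input `z` and ends
with the table `t'`, and `E` describes the distribution of the sequence of visible states. -/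
def Runs (z : InputVar n → Bool) (ms : CardProgram n q) (t t' : Table n q)
    (E : List (Visible n q) → PMF (List (Visible n q))) : Prop :=
  Safe z (fun u => u = t') ms t ∧
    ∀ h, exec ms ⟨t, h⟩ = (E h).map fun l => (⟨t', l⟩ : Stage n q)

theorem Runs.nil {z : InputVar n → Bool} {t : Table n q}
    (hr : ∀ v c card, t (.input v c) = some card → card.suit = encode (z v) c) :
    Runs z [] t t PMF.pure :=
  ⟨⟨hr, rfl⟩, fun h => by simp [exec, PMF.pure_map]⟩

theorem Runs.cons_of_pure {z : InputVar n → Bool} {m : Visible n q → CardAction n q}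
    {ms : CardProgram n q} {t u t' : Table n q}
    {E : List (Visible n q) → PMF (List (Visible n q))}
    (hr : ∀ v c card, t (.input v c) = some card → card.suit = encode (z v) c)
    (hl : (m t.visible).Legal t) (ho : (m t.visible).outcome t = PMF.pure u)
    (hu : Runs z ms u t' E) : Runs z (m :: ms) t t' (fun h => E (u.visible :: h)) :=
  ⟨safe_cons_of_pure hr hl ho hu.1, fun h => by rw [exec_cons_of_pure h ho, hu.2]⟩

/-- All outcomes of the random action are required to lead to the same final table, so that
randomness survives only in the visible states. -/
theorem Runs.cons_of_map {α : Type} {z : InputVar n → Bool} {m : Visible n q → CardAction n q}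
    {ms : CardProgram n q} {t t' : Table n q} (μ : PMF α) (u : α → Table n q)
    {E : α → List (Visible n q) → PMF (List (Visible n q))}
    (hr : ∀ v c card, t (.input v c) = some card → card.suit = encode (z v) c)
    (hl : (m t.visible).Legal t) (ho : (m t.visible).outcome t = μ.map u)
    (hu : ∀ a, Runs z ms (u a) t' (E a)) :
    Runs z (m :: ms) t t' (fun h => μ.bind fun a => E a ((u a).visible :: h)) := by
  refine ⟨⟨hr, hl, fun t'' ht'' => ?_⟩, fun h => ?_⟩
  · rw [ho, PMF.support_map] at ht''
    obtain ⟨a, -, rfl⟩ := ht''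
    exact (hu a).1
  · simp only [exec, stepWith, ho, PMF.bind_map, PMF.map_bind, Function.comp_def, (hu _).2]

theorem Runs.append {z : InputVar n → Bool} {ms ms' : CardProgram n q} {t u t' : Table n q}
    {E E' : List (Visible n q) → PMF (List (Visible n q))} (h : Runs z ms t u E)
    (h' : Runs z ms' u t' E') : Runs z (ms ++ ms') t t' (fun l => (E l).bind E') := by
  refine ⟨(safe_append _ _ _).2 (h.1.mono fun v hv => hv ▸ h'.1), fun l => ?_⟩
  rw [exec_append, h.2, PMF.bind_map, PMF.map_bind]
  congr 1
  funext l'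
  exact h'.2 l'

end CardProgram

/-! ### Executing register programs with cards -/

section

open CardProgram

variable {n : ℕ}

/-- The face-down commitments to the control and the helping bit have been shuffled: the control
bit is revealed, the remaining commitment becomes the commitment to the input variable `v`, and it
is returned to its input positions. -/
noncomputable def openAndReturn (v : InputVar n) {f : Registers → Registers}
    (hf : Function.Involutive f) : CardProgram n (2 * 10) :=
  [fun _ => .turn .alice (Slot.pos (.inr (.inl 0))),
    fun s => .rearrange (Slot.perm (Slot.cross_involutive
      (decide (s (Slot.pos (.inr (.inl 0))) = .face .heart)) hf)),
    fun s => .turn .alice (Slot.pos (.inl (.inr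
      (if s (Slot.pos (.inl (.inr 1))) = .back then 0 else 1)))),
    fun _ => .move .alice (Slot.pos (.inr (.inl 0))) (.input v 0),
    fun _ => .move .alice (Slot.pos (.inr (.inl 1))) (.input v 1)]

/-- The input cards of the variable `v` with numbers in `J`. -/
def inputCards (v : InputVar n) (J : Fin 2 → Bool) (a : InputVar n) (c : Fin 2) : Bool :=
  decide (a = v) && J c

/-- The visible continuation `k` is chosen before the input, the registers and the mask `b`: it
depends on the opened bit `β` alone. -/
theorem exists_runs_openAndReturn (v : InputVar n) {f : Registers → Registers}
    (hf : Function.Involutive f) :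
    ∃ k : Bool → List (Visible n (2 * 10)) → List (Visible n (2 * 10)),
      ∀ (x : InputVar n → Bool) (r : Registers) (b β : Bool), (b ^^ β) = x v →
        Runs x (openAndReturn v hf)
          (registerTable x (inputCards v fun _ => true) r (commitment b) (commitment β))
          (registerTable x (fun _ _ => false) (if β then f r else r) (commitment false)
            (fun _ => none))
          (fun h => PMF.pure (k β h)) := by
  let S := inputCards v fun _ => true
  let back : Fin 2 → Sight := fun _ => .back
  refine ⟨fun β h => registerVisible (fun _ _ => false) back (fun _ => .empty) ::
    registerVisible (inputCards v fun c => decide (c = 1)) back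
      (fun i => if i = 0 then .empty else .back) ::
    registerVisible S back back ::
    registerVisible S (fun i => sight (shown false (if β then 1 else 0) i)) back ::
    registerVisible S back (fun i => sight (shown β 0 i)) :: h, fun x r b β hb => ?_⟩
  have hro := fun S r δ p => registerTable_readOnly x S r δ p
  have hlast : (fun i : Fin 2 => sight (if i = 0 then none else commitment (x v) i)) =
      fun i => if i = 0 then .empty else .back := by
    funext i
    split_ifs <;> rfl
  have key := Runs.cons_of_pure (z := x) (m := fun _ => .turn .alice (Slot.pos (.inr (.inl 0))))
    (hro S r (commitment b) (commitment β))
    (by simp [CardAction.Legal, registerTable_pos, Slot.cards, commitment])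
    (outcome_turn_control x S r _ _ (p' := shown β 0) 0
      (by funext i; fin_cases i <;> simp [shown, commitment, Card.turn])) <|
    Runs.cons_of_pure (m := fun s => .rearrange (Slot.perm (Slot.cross_involutive
      (decide (s (Slot.pos (.inr (.inl 0))) = .face .heart)) hf))) (hro _ _ _ _) trivial
      (u := registerTable x S (if β then f r else r) (shown false (if β then 1 else 0))
        (commitment (b ^^ β)))
      (by
        have hs : decide ((registerTable x S r (commitment b) (shown β 0)).visible
            (Slot.pos (.inr (.inl 0))) = .face .heart) = β := by
          rw [visible_registerTable, (registerVisible_pos _ _ _ _).2]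
          cases β <;> rfl
        rw [← outcome_cross_registerTable x S r hf b β]
        simp only [hs]) <|
    -- Exactly one helping card is face-up, on position 1 if `β` holds and on position 0 otherwise;
    -- turning it restores the commitment to `0`.
    Runs.cons_of_pure (m := fun s => .turn .alice (Slot.pos (.inl (.inr
      (if s (Slot.pos (.inl (.inr 1))) = .back then 0 else 1)))))
      (hro _ _ _ _) (by simp [CardAction.Legal, registerTable_pos, Slot.cards, shown])
      (outcome_turn_helper x S _ _ _ (δ' := commitment false) _ (by
        rw [visible_registerTable, (registerVisible_pos _ _ _ _).1]
        funext i
        cases β <;> fin_cases i <;> simp [shown, commitment, Card.turn, sight])) <|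
    Runs.cons_of_pure (m := fun _ => .move .alice (Slot.pos (.inr (.inl 0))) (.input v 0))
      (hro _ _ _ _)
      (by simp [CardAction.Legal, registerTable_pos, Slot.cards, commitment, registerTable_input, S,
        inputCards])
      (outcome_move_of_control x S _ _ _ (S' := inputCards v fun c => decide (c = 1))
        (p' := fun i => if i = 0 then none else commitment (x v) i) v 0 (by rw [hb])
        (by
          intro a d
          by_cases ha : a = v <;> fin_cases d <;> simp [S, inputCards, ha])
        (by rw [hb]; funext i; fin_cases i <;> simp)) <|
    Runs.cons_of_pure (m := fun _ => .move .alice (Slot.pos (.inr (.inl 1))) (.input v 1))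
      (hro _ _ _ _)
      (by simp [CardAction.Legal, registerTable_pos, Slot.cards, commitment, registerTable_input,
        inputCards])
      (outcome_move_of_control x _ _ _ _ (S' := fun _ _ => false) (p' := fun _ => none) v 1
        (by simp)
        (by
          intro a d
          by_cases ha : a = v <;> fin_cases d <;> simp [inputCards, ha])
        (by funext i; fin_cases i <;> simp)) <|
    Runs.nil (hro _ _ _ _)
  simp only [visible_registerTable, hlast] at key
  exact key

/-- The card program that executes an instruction of a register program. -/
noncomputable def RegisterInstr.cardProgram (I : RegisterInstr (InputVar n)) :
    CardProgram n (2 * 10) :=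
  match I.src with
  | none => [fun _ => .rearrange (Slot.perm (Slot.onRegisters_involutive I.invol))]
  | some v =>
    (fun _ => .move .alice (.input v 0) (Slot.pos (.inr (.inl 0)))) ::
    (fun _ => .move .alice (.input v 1) (Slot.pos (.inr (.inl 1)))) ::
    (fun _ => .bisection (Slot.perm (Slot.bisect_involutive I.invol))) ::
    openAndReturn v I.invol

theorem RegisterInstr.length_cardProgram_le (I : RegisterInstr (InputVar n)) :
    I.cardProgram.length ≤ 8 := by
  unfold cardProgram
  split <;> simp [openAndReturn]

/-- The table that stores the state `r` of the registers, with all input cards in place. -/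
noncomputable def restTable (x : InputVar n → Bool) (r : Registers) : Table n (2 * 10) :=
  registerTable x (fun _ _ => false) r (commitment false) (fun _ => none)

/-- The law `E` of the visible states is fixed before the input and the registers; this order of
quantifiers is the security statement. -/
theorem RegisterInstr.exists_runs_cardProgram (I : RegisterInstr (InputVar n)) :
    ∃ E, ∀ x r, Runs x I.cardProgram (restTable x r) (restTable x (I.apply x r)) E := by
  obtain ⟨src, f, hf⟩ := I
  cases src with
  | none =>
    refine ⟨fun h => PMF.pure (registerVisible (fun _ _ => false) (fun _ => .back)
      (fun _ => .empty) :: h), fun x r => ?_⟩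
    have key := Runs.cons_of_pure (z := x)
      (m := fun _ => .rearrange (Slot.perm (Slot.onRegisters_involutive hf)))
      (registerTable_readOnly x (fun _ _ => false) r (commitment false) (fun _ => none)) trivial
      (outcome_onRegisters_registerTable x _ r _ _ hf) <|
      Runs.nil (registerTable_readOnly x _ _ _ _)
    simp only [visible_registerTable] at key
    exact key
  | some v =>
    obtain ⟨k, hk⟩ := exists_runs_openAndReturn v hf
    let back : Fin 2 → Sight := fun _ => .back
    let S := inputCards v fun _ => true
    refine ⟨fun h => (PMF.uniformOfFintype Bool).bind fun β => PMF.pure (k β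
      (registerVisible S back back :: registerVisible S back back ::
      registerVisible (inputCards v fun c => decide (c = 0)) back
        (fun i => if i = 0 then .back else .empty) :: h)), fun x r => ?_⟩
    have hro := fun S r δ p => registerTable_readOnly x S r δ p
    have hfirst : (fun i : Fin 2 => sight (if i = 0 then commitment (x v) i else none)) =
        fun i => if i = 0 then .back else .empty := by
      funext i
      split_ifs <;> rfl
    have key := Runs.cons_of_pure (z := x)
      (m := fun _ => .move .alice (.input v 0) (Slot.pos (.inr (.inl 0))))
      (hro (fun _ _ => false) r (commitment false) (fun _ => none))
      (by simp [CardAction.Legal, registerTable_pos, Slot.cards, registerTable_input])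
      (outcome_move_to_control x _ r _ _ (S' := inputCards v fun c => decide (c = 0))
        (p' := fun i => if i = 0 then commitment (x v) i else none) v 0 rfl
        (by intro a d; simp [inputCards])
        (by funext i; fin_cases i <;> simp)) <|
      Runs.cons_of_pure (m := fun _ => .move .alice (.input v 1) (Slot.pos (.inr (.inl 1))))
        (hro _ _ _ _)
        (by simp [CardAction.Legal, registerTable_pos, Slot.cards, registerTable_input,
          inputCards])
        (outcome_move_to_control x _ r _ _ (S' := S) (p' := commitment (x v)) v 1
          (by simp [inputCards])
          (by
            intro a d
            by_cases ha : a = v <;> fin_cases d <;> simp [S, inputCards, ha])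
          (by funext i; fin_cases i <;> simp)) <|
      Runs.cons_of_map (m := fun _ => .bisection (Slot.perm (Slot.bisect_involutive hf)))
        (PMF.uniformOfFintype Bool) _ (hro _ _ _ _) trivial
        (outcome_bisection_registerTable x S r hf false (x v))
        (t' := restTable x (RegisterInstr.apply x ⟨some v, f, hf⟩ r))
        -- The map is applied once for `b` and once for the opened bit `x v ^^ b`: exactly once in
        -- total if `x v = 1`, and never or twice if `x v = 0`.
        (E := fun b h => PMF.pure (k (x v ^^ b) h)) (fun b => by
          have := hk x (if b then f r else r) (false ^^ b) (x v ^^ b) (by cases b <;> simp)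
          convert this using 2
          cases hx : x v <;> cases b <;> simp [restTable, RegisterInstr.apply, hx, hf r])
    simp only [visible_registerTable, hfirst] at key
    -- The random bit is replaced by the opened one, which is uniform too; this removes `x v` from
    -- the law.
    have hE : ∀ g : Bool → PMF (List (Visible n (2 * 10))),
        (PMF.uniformOfFintype Bool).bind (fun b => g (x v ^^ b)) =
          (PMF.uniformOfFintype Bool).bind g := by
      intro g
      conv_rhs => rw [← PMF.map_xor_uniformOfFintype (x v), PMF.bind_map]
      rfl
    refine Eq.mpr (congrArg (Runs x _ _ _) (funext fun h => ?_)) key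
    exact (hE fun β => PMF.pure (k β _)).symm

/-- The card program that executes a register program. -/
noncomputable def registerCardProgram (prog : List (RegisterInstr (InputVar n))) :
    CardProgram n (2 * 10) :=
  prog.flatMap RegisterInstr.cardProgram

theorem length_registerCardProgram_le (prog : List (RegisterInstr (InputVar n))) :
    (registerCardProgram prog).length ≤ 8 * prog.length := by
  induction prog with
  | nil => simp [registerCardProgram]
  | cons I prog ih =>
    have := I.length_cardProgram_le
    simp only [registerCardProgram, List.flatMap_cons, List.length_append, List.length_cons] at *
    omega

theorem exists_runs_registerCardProgram (prog : List (RegisterInstr (InputVar n))) :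
    ∃ E, ∀ x r, Runs x (registerCardProgram prog) (restTable x r)
      (restTable x (RegisterInstr.run x prog r)) E := by
  induction prog with
  | nil => exact ⟨_, fun x r => Runs.nil (registerTable_readOnly x _ _ _ _)⟩
  | cons I prog ih =>
    obtain ⟨E, hE⟩ := I.exists_runs_cardProgram
    obtain ⟨E', hE'⟩ := ih
    exact ⟨_, fun x r => (hE x r).append (hE' x _)⟩

/-- The deck that stores the state `r` of the registers and a commitment to `0`. -/
noncomputable def registerDeck (r : Registers) (k : Fin 10) : Card :=
  (Slot.cards r (commitment false) (fun _ => none)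
    (Slot.equiv.symm (Fin.castLE (by norm_num) k))).getD ⟨.club, false⟩

theorem initialTable_registerCardProgram (prog : List (RegisterInstr (InputVar n)))
    (r : Registers) (i j : Pos n (2 * 10)) (x y : Fin n → Bool) :
    ((registerCardProgram prog).toProtocol (registerDeck r) i j).initialTable x y =
      restTable (joint x y) r := by
  refine Table.ext_slots (fun a c => rfl) fun s => ?_
  rw [restTable, registerTable_pos, Slot.pos]
  rcases s with s | s
  · have hs := Slot.equiv_inl_lt s
    simp only [Protocol.initialTable, hs, dite_true, toProtocol, registerDeck]
    have : Fin.castLE (by norm_num) (⟨(Slot.equiv (.inl s)).1, hs⟩ : Fin 10) =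
      Slot.equiv (.inl s) := rfl
    rw [this, Equiv.symm_apply_apply]
    rcases s with a | i <;> rfl
  · have hs := Slot.le_equiv_inr s
    simp only [Protocol.initialTable, not_lt.2 hs, dite_false]
    rcases s with i | k <;> rfl

/-- In the one-hot encoding the answer needs no decoding. The register program ends in one of two
known states `r'` and `r`, according to the value of `f`, and the two cards for these states, in
this order, already form a face-down commitment to it. -/
theorem NC1_subset_SPFaceDown : NC1 ⊆ SPFaceDown := by
  intro f hf
  obtain ⟨c, hc⟩ := (mem_NC1_iff f).1 hf
  refine ⟨10, by norm_num, 8 * (2 * (Polynomial.X + 1)) ^ (3 * c), fun n => ?_⟩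
  obtain ⟨F, hd, hF⟩ := hc n
  obtain ⟨prog, hlen, hprog⟩ := F.exists_registerProgram 0 1 (by decide)
  obtain ⟨E, hE⟩ := exists_runs_registerCardProgram prog
  -- Register 1 holds the constant `1`, so adding it to register 0 under the condition `F` writes
  -- the value of the formula there.
  let r : Registers := fun k => decide (k = 1)
  let r' : Registers := Registers.addIf true 0 1 r
  have hr : r ≠ r' := fun h => by simpa [r, r', Registers.addIf] using congrFun h 0
  let i : Pos n (2 * 10) := Slot.pos (.inl (.inl r'))
  let j : Pos n (2 * 10) := Slot.pos (.inl (.inl r))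
  let ms := registerCardProgram prog
  have hinit := initialTable_registerCardProgram prog r i j
  have hsafe : ∀ x y, Safe (joint x y)
      (fun t => t = restTable (joint x y) (if f n x y then r' else r)) ms
      ((ms.toProtocol (registerDeck r) i j).initialTable x y) := by
    intro x y
    have h := (hE (joint x y) r).1
    rw [hprog, hF] at h
    rw [hinit]
    convert h using 4
    cases f n x y
    · exact (Registers.addIf_false 0 1 r).symm
    · rfl
  have hcards : ∀ (x : InputVar n → Bool) (r₁ r₂ : Registers),
      restTable x r₁ (Slot.pos (.inl (.inl r₂))) =
        some ⟨if r₂ = r₁ then .heart else .club, false⟩ :=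
    fun x r₁ r₂ => registerTable_pos x _ r₁ _ _ _
  refine ⟨ms.toProtocol (registerDeck r) i j,
    isLegal_toProtocol _ _ _ _ fun x y => ⟨_, hsafe x y⟩,
    lengthAtMost_toProtocol _ _ _ _ ?_, ?_, isOblivious_toProtocol _ _ _ _,
    isReadOnly_toProtocol _ _ _ _ fun x y => ⟨_, hsafe x y⟩, ?_, ?_⟩
  · have h₁ : 6 ^ F.depth ≤ 2 ^ (3 * c * (Nat.log 2 n + 1)) := by
      calc 6 ^ F.depth ≤ 8 ^ F.depth := Nat.pow_le_pow_left (by norm_num) _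
        _ ≤ 8 ^ (c * (Nat.log 2 n + 1)) := Nat.pow_le_pow_right (by norm_num) hd
        _ = 2 ^ (3 * c * (Nat.log 2 n + 1)) := by
          rw [mul_assoc 3, pow_mul 2 3]
          norm_num
    have h₂ := two_pow_log_le (3 * c) n
    have h₃ := length_registerCardProgram_le prog
    rw [Polynomial.eval_mul, Polynomial.eval_ofNat]
    calc ms.length ≤ 8 * prog.length := h₃
      _ ≤ _ := Nat.mul_le_mul_left _ (hlen.trans (h₁.trans h₂))
  · intro x y σ i' j' hσ hfin
    obtain ⟨ht, rfl, rfl⟩ := of_finish_toProtocol _ _ _ _ (hsafe x y) hσ hfin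
    rw [ht, hcards, hcards]
    cases f n x y <;> simp [encode, hr, hr.symm]
  · intro x y σ i' j' hσ hfin
    obtain ⟨ht, rfl, rfl⟩ := of_finish_toProtocol _ _ _ _ (hsafe x y) hσ hfin
    rw [ht, hcards, hcards]
    exact ⟨rfl, rfl⟩
  · refine isFullySecure_toProtocol _ _ _ _ fun x y x' y' => ?_
    have h : ∀ x y, (exec ms ((ms.toProtocol (registerDeck r) i j).initialStage x y)).map
        Stage.history = E [(restTable (fun _ => false) r).visible] := by
      intro x y
      rw [Protocol.initialStage, hinit, (hE _ _).2, PMF.map_comp]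
      simp only [restTable, visible_registerTable]
      exact PMF.map_id _
    rw [h, h]

end

/-! ### Conclusion -/

theorem SPFaceDown_subset_SP : SPFaceDown ⊆ SP := by
  rintro f ⟨s, hs, p, h⟩
  refine ⟨s, hs, p, fun n => ?_⟩
  obtain ⟨P, hl, hL, hC, hO, hR, -, hS⟩ := h n
  exact ⟨P, hl, hL, hC, hO, hR, fun x y x' y' _ k => hS x y x' y' k⟩

theorem theorem2 :
    SP = NC1 ∧ SPFaceDown = NC1 ∧ PBP 5 ⊆ SP ∧ SP ⊆ PB := by
  have h₁ : SP ⊆ NC1 := SP_subset_PB.trans PB_subset_NC1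
  have h₂ : NC1 ⊆ SP := NC1_subset_SPFaceDown.trans SPFaceDown_subset_SP
  exact ⟨h₁.antisymm h₂, (SPFaceDown_subset_SP.trans h₁).antisymm NC1_subset_SPFaceDown,
    (PBP_subset_PB 5).trans (PB_subset_NC1.trans h₂), SP_subset_PB⟩
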